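/- An \emph{arc} is a closed circular arc in the plane, centered at the origin, of positive radius, whose endpoints have arguments $\alpha<\beta$ with $\beta-\alpha<2\pi$. Let $k\ge 0$ be an integer. A finite simple graph $G$ is an \emph{arc $k$-visibility graph} if one can assign to its vertices $v$ pairwise disjoint arcs $a_v$ such that two distinct vertices $u,v$ are adjacent if and only if there is a line segment with one endpoint on $a_u$ and the other on $a_v$, contained in a line through the origin (it may pass through the origin), which intersects at most $k$ of the arcs $a_w$ with $w\ne u,v$; here an arc that the segment intersects twice is counted only once. \textbf{Theorem.} Let $G$ be an arc $k$-visibility graph with $n$ vertices. If $n\le 4k+4$, then $G$ has at most $\binom n2$ edges. If $n>4k+4$, then $G$ has at most $(k+1)\left(3n-\frac{3k+6}{2}\right)$ edges. -/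

import Mathlib

/-- A circular arc about the origin of the plane `ℂ`: it has positive radius, and its endpoints
have arguments `neg` (the negative endpoint) and `pos` (the positive endpoint), chosen such that
`0 < pos - neg < 2 * π`. -/
structure CircularArc where
  /-- the radius of the arc -/
  radius : ℝ
  /-- the argument of the negative endpoint -/
  neg : ℝ
  /-- the argument of the positive endpoint -/
  pos : ℝ
  radius_pos : 0 < radius
  neg_lt_pos : neg < pos
  pos_lt : pos < neg + 2 * Real.pi

/-- The set of points of a circular arc; both endpoints belong to it. -/
def CircularArc.points (A : CircularArc) : Set ℂ :=
  (fun θ : ℝ => (A.radius : ℂ) * Complex.exp ((θ : ℂ) * Complex.I)) '' Set.Icc A.neg A.pos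

/-- The segment from `p` to `q` is radial: it lies on a line through the center (the origin).
It may pass through the center. -/
def IsRadial (p q : ℂ) : Prop :=
  Collinear ℝ {0, p, q}

/-- Two distinct arcs `a u`, `a v` of a family of arcs see each other through at most `k` arcs if
some radial segment from a point of `a u` to a point of `a v` meets at most `k` of the other arcs.
An arc that meets the segment twice is counted once. -/
def KVisible {V : Type*} (a : V → CircularArc) (k : ℕ) (u v : V) : Prop :=
  u ≠ v ∧ ∃ p ∈ (a u).points, ∃ q ∈ (a v).points, IsRadial p q ∧
    {w : V | w ≠ u ∧ w ≠ v ∧ ((a w).points ∩ segment ℝ p q).Nonempty}.encard ≤ (k : ℕ∞)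

/-- `a` is an arc `k`-visibility representation of `G`: the arcs are pairwise disjoint, and two
vertices are adjacent exactly if their arcs see each other through at most `k` arcs. -/
def IsArcVisibilityRepresentation {V : Type*} (k : ℕ) (G : SimpleGraph V)
    (a : V → CircularArc) : Prop :=
  (∀ u v : V, u ≠ v → Disjoint (a u).points (a v).points) ∧
    ∀ u v : V, G.Adj u v ↔ KVisible a k u v

/-- Arc `k`-visibility graphs. -/
def IsArcVisibilityGraph {V : Type*} (k : ℕ) (G : SimpleGraph V) : Prop :=
  ∃ a : V → CircularArc, IsArcVisibilityRepresentation k G a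

/-! Put m = k + 1, number the arcs 1, …, n by radius, and rotate a line about the origin. At each
instant the line carries a row of bars, z > 0 on one ray and z < 0 on the other. Adjacent arcs have,
at some instant, bars separated by fewer than m other arcs.

For each edge take a visible pair of bars at least distance `x - y`, at an instant when its
visibility ends. Either one of the two bars disappears or a bar appears between them
(`edges_classify`). A disappearing arc sees at most m arcs on each side, hence accounts for at most
2m edges. An appearing arc interrupts at most m, because the interrupted pairs are not nested
(`card_openSlots_le`). This gives 3mn. Both local bounds improve by the deficits m - |up| and m -
|dn| when fewer than m arcs lie on a side.

The remaining saving of 3m(m+1)/2 comes from the m outermost arcs u, whose disappearances are not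
counted in this way. The pairs among them number m(m-1)/2; of the other edges at u, only the loose
ones, which end solely when u disappears, still have to be counted. Consider the first |nested u| +
1 arcs below u apart from `inner u`. If one of them is a loose neighbour, some event must disturb it
during the gap of u: otherwise u would see it again on reappearing and keep seeing it until
disappearing, so that a single bar would be present for a full turn. The event is charged to u
(`card_loose_le`). An event of the bar z at t is charged to at most m - |up z t| arcs
(`card_charged_le`), so the deficits pay for all charges. The one unspent kind of deficit, above the
outermost arcs when they appear, is combined with `inner` and `nested` in `sum_up_le`.

All this assumes that the line always meets more than m arcs. If it does not, an arc can be
prolonged without losing an edge (`exists_longer`), and bounded total length makes this stop. The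
passage from real angles to integer instants is `exists_barSystem`. -/

noncomputable section

open Finset
open scoped Classical

/-! ### Line sweeps: bars, visibility, half-turn symmetry -/

/-- A rotating line sweep.  The arcs are `1, …, n`, ordered by radius; the bars `z` and `-z` are the
traces of the arc `|z|` on the two rays of the line.  `Pr z t` says that the bar `z` is met at the
instant `t`; after `T` instants the two rays are interchanged.  At each step at most one bar
appears or disappears, and each bar appears and disappears once in a full turn. -/
structure Sweep (n : ℕ) where
  T : ℤ
  Pr : ℤ → ℤ → Prop
  op : ℤ → ℤ
  cl : ℤ → ℤ
  T_pos : 0 < T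
  ne_zero : ∀ {z t : ℤ}, Pr z t → z ≠ 0
  abs_le : ∀ {z t : ℤ}, Pr z t → |z| ≤ n
  flip : ∀ {z t : ℤ}, Pr (-z) t ↔ Pr z (t + T)
  single : ∀ {z z' t : ℤ}, (Pr z t ↔ ¬ Pr z (t + 1)) → (Pr z' t ↔ ¬ Pr z' (t + 1)) → z = z'
  not_pr_op : ∀ {z : ℤ}, z ≠ 0 → |z| ≤ n → ¬ Pr z (op z)
  pr_op : ∀ {z : ℤ}, z ≠ 0 → |z| ≤ n → Pr z (op z + 1)
  pr_cl : ∀ {z : ℤ}, z ≠ 0 → |z| ≤ n → Pr z (cl z)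
  not_pr_cl : ∀ {z : ℤ}, z ≠ 0 → |z| ≤ n → ¬ Pr z (cl z + 1)
  op_unique : ∀ {z t : ℤ}, ¬ Pr z t → Pr z (t + 1) → ∃ i : ℤ, t = op z + 2 * T * i
  cl_unique : ∀ {z t : ℤ}, Pr z t → ¬ Pr z (t + 1) → ∃ i : ℤ, t = cl z + 2 * T * i

namespace Sweep

variable {n : ℕ} (S : Sweep n) (m : ℕ)

/-- The set of arcs. -/
def arcs (_ : Sweep n) : Finset ℤ := Icc 1 (n : ℤ)

/-- The arcs that separate the bars `y < x`. -/
def blk (x y t : ℤ) : Finset ℤ :=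
  S.arcs.filter fun c => c ≠ |x| ∧ c ≠ |y| ∧ ∃ z, y < z ∧ z < x ∧ |z| = c ∧ S.Pr z t

/-- The bar `x` sees the lower bar `y` through fewer than `m` arcs. -/
def Vis (x y t : ℤ) : Prop :=
  S.Pr x t ∧ S.Pr y t ∧ y < x ∧ |x| ≠ |y| ∧ (S.blk x y t).card < m

/-- The edges of the visibility graph. -/
def edges : Finset (Sym2 ℤ) :=
  S.arcs.sym2.filter fun s => ∃ x y t, S.Vis m x y t ∧ s = s(|x|, |y|)

/-- No visible pair of bars of the same arcs is nested in `x`, `y`. -/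
def Fresh (x y t : ℤ) : Prop :=
  ∀ x' y', y ≤ y' → x' ≤ x → S.Vis m x' y' t → s(|x'|, |y'|) = s(|x|, |y|) → x' = x ∧ y' = y

/-- The other arcs above a bar. -/
def up (z t : ℤ) : Finset ℤ :=
  S.arcs.filter fun c => c ≠ |z| ∧ ∃ y, z < y ∧ |y| = c ∧ S.Pr y t

/-- The other arcs below a bar. -/
def dn (z t : ℤ) : Finset ℤ :=
  S.arcs.filter fun c => c ≠ |z| ∧ ∃ y, y < z ∧ |y| = c ∧ S.Pr y t

/-- The arcs above a bar that it sees. -/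
def seenUp (z t : ℤ) : Finset ℤ :=
  S.arcs.filter fun c => ∃ y, |y| = c ∧ S.Vis m y z t

/-- The arcs below a bar that it sees. -/
def seenDn (z t : ℤ) : Finset ℤ :=
  S.arcs.filter fun c => ∃ y, |y| = c ∧ S.Vis m z y t

/-- The edges at `w` that are visible when `w` disappears. -/
def closeSlots (w : ℤ) : Finset (Sym2 ℤ) :=
  (S.seenUp m w (S.cl w) ∪ S.seenDn m w (S.cl w)).image fun a => s(w, a)

/-- The edges that the appearance of `w` interrupts. -/
def openSlots (w : ℤ) : Finset (Sym2 ℤ) :=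
  S.arcs.sym2.filter fun s => ∃ x y, s = s(|x|, |y|) ∧ y < w ∧ w < x ∧
    S.Vis m x y (S.op w) ∧ ¬ S.Vis m x y (S.op w + 1) ∧
    S.Pr x (S.op w + 1) ∧ S.Pr y (S.op w + 1) ∧ S.Fresh m x y (S.op w)

/-- The arcs met by the line. -/
def line (t : ℤ) : Finset ℤ := S.arcs.filter fun c => S.Pr c t ∨ S.Pr (-c) t

variable {S m}

lemma mem_arcs {c : ℤ} : c ∈ S.arcs ↔ 1 ≤ c ∧ c ≤ n := by simp [arcs]

lemma abs_mem_arcs {z t : ℤ} (h : S.Pr z t) : |z| ∈ S.arcs :=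
  mem_arcs.2 ⟨Int.one_le_abs (S.ne_zero h), S.abs_le h⟩

lemma ne_zero_of_mem {w : ℤ} (h : w ∈ S.arcs) : w ≠ 0 := by have := mem_arcs.1 h; omega

lemma abs_of_mem {w : ℤ} (h : w ∈ S.arcs) : |w| = w := by
  have := mem_arcs.1 h; exact abs_of_pos (by omega)

lemma abs_le_of_mem {w : ℤ} (h : w ∈ S.arcs) : |w| ≤ n := by
  rw [abs_of_mem h]; exact (mem_arcs.1 h).2

lemma period_one {z t : ℤ} : S.Pr z (t + 2 * S.T) ↔ S.Pr z t := by
  have h1 := S.flip (z := z) (t := t + S.T)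
  have h2 := S.flip (z := -z) (t := t)
  rw [neg_neg] at h2
  rw [h2, h1]; ring_nf

lemma period {z t : ℤ} (i : ℤ) : S.Pr z (t + 2 * S.T * i) ↔ S.Pr z t := by
  induction i using Int.induction_on with
  | zero => simp
  | succ i ih =>
    rw [← ih, ← period_one (S := S) (t := t + 2 * S.T * i)]; ring_nf
  | pred i ih =>
    rw [← ih, ← period_one (S := S) (t := t + 2 * S.T * (-i - 1))]; ring_nf

/-- A half turn interchanges the rays: it sends `z` to `-z` and reverses the order along the line.
This and its analogues reduce negative bars to positive ones. -/
lemma blk_flip {x y t : ℤ} : S.blk (-y) (-x) t = S.blk x y (t + S.T) := by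
  ext c
  simp only [blk, mem_filter, abs_neg]
  refine and_congr_right fun _ => ⟨?_, ?_⟩
  · rintro ⟨h1, h2, z, h3, h4, h5, h6⟩
    exact ⟨h2, h1, -z, by omega, by omega, by simpa, by rw [← S.flip, neg_neg]; exact h6⟩
  · rintro ⟨h1, h2, z, h3, h4, h5, h6⟩
    exact ⟨h2, h1, -z, by omega, by omega, by simpa, by rw [S.flip]; exact h6⟩

lemma vis_flip {x y t : ℤ} : S.Vis m (-y) (-x) t ↔ S.Vis m x y (t + S.T) := by
  simp only [Vis, blk_flip, abs_neg, S.flip]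
  constructor
  · rintro ⟨h1, h2, h3, h4, h5⟩; exact ⟨h2, h1, by omega, h4.symm, h5⟩
  · rintro ⟨h1, h2, h3, h4, h5⟩; exact ⟨h2, h1, by omega, h4.symm, h5⟩

lemma vis_period {x y t : ℤ} (i : ℤ) : S.Vis m x y (t + 2 * S.T * i) ↔ S.Vis m x y t := by
  simp only [Vis, blk, period]

lemma fresh_flip {x y t : ℤ} : S.Fresh m (-y) (-x) t ↔ S.Fresh m x y (t + S.T) := by
  constructor
  · intro h x' y' hy hx hv hs
    have := h (-y') (-x') (by omega) (by omega) (vis_flip.2 hv)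
      (by rw [abs_neg, abs_neg, abs_neg, abs_neg, Sym2.eq_swap, hs, Sym2.eq_swap])
    omega
  · intro h x' y' hy hx hv hs
    have := h (-y') (-x') (by omega) (by omega) (by rw [← vis_flip]; simpa using hv)
      (by rw [abs_neg, abs_neg, Sym2.eq_swap, hs, abs_neg, abs_neg, Sym2.eq_swap])
    omega

lemma fresh_period {x y t : ℤ} (i : ℤ) : S.Fresh m x y (t + 2 * S.T * i) ↔ S.Fresh m x y t := by
  simp only [Fresh, vis_period]

lemma up_neg {z t : ℤ} : S.up (-z) t = S.dn z (t + S.T) := by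
  ext c
  simp only [up, dn, mem_filter, abs_neg]
  refine and_congr_right fun _ => and_congr_right fun _ => ⟨?_, ?_⟩
  · rintro ⟨y, h3, h5, h6⟩
    exact ⟨-y, by omega, by simpa, by rw [← S.flip, neg_neg]; exact h6⟩
  · rintro ⟨y, h3, h5, h6⟩
    exact ⟨-y, by omega, by simpa, by rw [S.flip]; exact h6⟩

lemma dn_period {z t : ℤ} (i : ℤ) : S.dn z (t + 2 * S.T * i) = S.dn z t := by
  simp only [dn, period]

lemma seenUp_neg {z t : ℤ} : S.seenUp m (-z) t = S.seenDn m z (t + S.T) := by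
  ext c
  simp only [seenUp, seenDn, mem_filter]
  refine and_congr_right fun _ => ⟨?_, ?_⟩
  · rintro ⟨y, h3, h5⟩
    exact ⟨-y, by simpa, by rw [← vis_flip, neg_neg]; exact h5⟩
  · rintro ⟨y, h3, h5⟩
    exact ⟨-y, by simpa, by rw [vis_flip]; exact h5⟩

lemma mem_blk {x y t c : ℤ} : c ∈ S.blk x y t ↔
    c ≠ |x| ∧ c ≠ |y| ∧ ∃ z, y < z ∧ z < x ∧ |z| = c ∧ S.Pr z t := by
  simp only [blk, mem_filter, and_iff_right_iff_imp]
  rintro ⟨-, -, z, -, -, rfl, h⟩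
  exact abs_mem_arcs h

lemma mem_up {z t c : ℤ} : c ∈ S.up z t ↔ c ≠ |z| ∧ ∃ y, z < y ∧ |y| = c ∧ S.Pr y t := by
  simp only [up, mem_filter, and_iff_right_iff_imp]
  rintro ⟨-, z, -, rfl, h⟩
  exact abs_mem_arcs h

lemma mem_dn {z t c : ℤ} : c ∈ S.dn z t ↔ c ≠ |z| ∧ ∃ y, y < z ∧ |y| = c ∧ S.Pr y t := by
  simp only [dn, mem_filter, and_iff_right_iff_imp]
  rintro ⟨-, z, -, rfl, h⟩
  exact abs_mem_arcs h

lemma mem_seenUp {z t c : ℤ} : c ∈ S.seenUp m z t ↔ ∃ y, |y| = c ∧ S.Vis m y z t := by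
  simp only [seenUp, mem_filter, and_iff_right_iff_imp]
  rintro ⟨y, rfl, h⟩
  exact abs_mem_arcs h.1

lemma mem_seenDn {z t c : ℤ} : c ∈ S.seenDn m z t ↔ ∃ y, |y| = c ∧ S.Vis m z y t := by
  simp only [seenDn, mem_filter, and_iff_right_iff_imp]
  rintro ⟨y, rfl, h⟩
  exact abs_mem_arcs h.2.1

lemma mem_edges {s : Sym2 ℤ} : s ∈ S.edges m ↔ ∃ x y t, S.Vis m x y t ∧ s = s(|x|, |y|) := by
  simp only [edges, mem_filter, and_iff_right_iff_imp]
  rintro ⟨x, y, t, h, rfl⟩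
  exact Finset.mk_mem_sym2_iff.2 ⟨abs_mem_arcs h.1, abs_mem_arcs h.2.1⟩

/-- A visible pair stays visible when shortened to bars of the same arcs. -/
lemma Vis.shorten {x y x' y' t : ℤ} (h : S.Vis m x y t) (hx : x' ≤ x) (hy : y ≤ y') (hlt : y' < x')
    (px : S.Pr x' t) (py : S.Pr y' t) (hs : s(|x'|, |y'|) = s(|x|, |y|)) : S.Vis m x' y' t := by
  have hs' := hs
  rw [Sym2.eq_iff] at hs'
  refine ⟨px, py, hlt, ?_, lt_of_le_of_lt (card_le_card ?_) h.2.2.2.2⟩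
  · have := h.2.2.2.1
    rcases hs' with ⟨h1, h2⟩ | ⟨h1, h2⟩ <;> rw [h1, h2]
    · exact this
    · exact this.symm
  · intro c hc
    rw [mem_blk] at hc ⊢
    obtain ⟨h1, h2, z, h3, h4, h5, h6⟩ := hc
    refine ⟨?_, ?_, z, by omega, by omega, h5, h6⟩ <;>
    rcases hs' with ⟨e1, e2⟩ | ⟨e1, e2⟩ <;> simp_all

/-- A set in which each element has fewer than `m` elements above it has at most `m` elements. -/
lemma card_le_of_key {α : Type*} {R : Finset α} {f : α → ℤ} (hf : Set.InjOn f R)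
    (h : ∀ a ∈ R, (R.filter fun b => f a < f b).card < m) : R.card ≤ m := by
  rcases R.eq_empty_or_nonempty with rfl | hne
  · simp
  obtain ⟨a, ha, hmin⟩ := R.exists_min_image f hne
  have h1 := h a ha
  have : R.erase a ⊆ R.filter fun b => f a < f b := by
    intro b hb
    rw [mem_erase] at hb
    refine mem_filter.2 ⟨hb.2, lt_of_le_of_ne (hmin b hb.2) fun e => hb.1 (hf hb.2 ha e.symm)⟩
  have := card_le_card this
  rw [card_erase_of_mem ha] at this
  omega

/-- The first `q` elements of a set exist. -/
lemma le_card_of_key {α : Type*} {R : Finset α} {f : α → ℤ} {q : ℕ} (hq : q ≤ R.card) :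
    q ≤ (R.filter fun a => (R.filter fun b => f a < f b).card < q).card := by
  by_contra! hlt
  set A := R.filter fun a => (R.filter fun b => f a < f b).card < q with hA
  have hne : (R \ A).Nonempty := by
    rw [nonempty_iff_ne_empty, Ne, sdiff_eq_empty_iff_subset]
    intro hs
    have := card_le_card hs
    omega
  obtain ⟨a, ha, hmax⟩ := (R \ A).exists_max_image f hne
  rw [mem_sdiff] at ha
  refine ha.2 (mem_filter.2 ⟨ha.1, lt_of_le_of_lt (card_le_card ?_) hlt⟩)
  intro b hb
  rw [mem_filter] at hb
  by_contra hbA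
  have := hmax b (mem_sdiff.2 ⟨hb.1, hbA⟩)
  omega

lemma seenUp_subset {z t : ℤ} : S.seenUp m z t ⊆ S.up z t := by
  intro c hc
  obtain ⟨y, rfl, h⟩ := mem_seenUp.1 hc
  exact mem_up.2 ⟨h.2.2.2.1, y, h.2.2.1, rfl, h.1⟩

lemma seenDn_subset {z t : ℤ} : S.seenDn m z t ⊆ S.dn z t := by
  intro c hc
  obtain ⟨y, rfl, h⟩ := mem_seenDn.1 hc
  exact mem_dn.2 ⟨h.2.2.2.1.symm, y, h.2.2.1, rfl, h.2.1⟩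

/-- Choose one visible bar for each seen arc. The chosen bars above a given one belong to distinct
blockers of it, so there are fewer than m of them, and `card_le_of_key` applies. -/
lemma card_seenDn_le {z t : ℤ} : (S.seenDn m z t).card ≤ m := by
  have hch : ∀ c : ℤ, ∃ y, c ∈ S.seenDn m z t → |y| = c ∧ S.Vis m z y t := by
    intro c
    by_cases hc : c ∈ S.seenDn m z t
    · obtain ⟨y, h⟩ := mem_seenDn.1 hc; exact ⟨y, fun _ => h⟩
    · exact ⟨0, fun h => absurd h hc⟩
  choose f hf using hch
  refine card_le_of_key (f := f) ?_ ?_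
  · intro a ha b hb e
    rw [← (hf a ha).1, ← (hf b hb).1, e]
  · intro a ha
    refine lt_of_le_of_lt (card_le_card ?_) (hf a ha).2.2.2.2.2
    intro b hb
    rw [mem_filter] at hb
    obtain ⟨hb1, hb2⟩ := hb
    have hvb := (hf b hb1).2
    refine mem_blk.2 ⟨?_, ?_, f b, hb2, hvb.2.2.1, (hf b hb1).1, hvb.2.1⟩
    · rw [← (hf b hb1).1]; exact hvb.2.2.2.1.symm
    · rw [(hf a ha).1]
      rintro rfl
      exact lt_irrefl _ hb2

lemma card_seenUp_le {z t : ℤ} : (S.seenUp m z t).card ≤ m := by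
  rw [← neg_neg z, seenUp_neg]; exact card_seenDn_le

/-- The arc sees at most min(m, |up|) arcs above and min(m, |dn|) below. The deficits are kept in
the bound since they later pay for charged events. -/
lemma card_closeSlots_le {w : ℤ} :
    (S.closeSlots m w).card + (m - (S.up w (S.cl w)).card) + (m - (S.dn w (S.cl w)).card) ≤
      2 * m := by
  have h1 : (S.closeSlots m w).card ≤ (S.seenUp m w (S.cl w)).card + (S.seenDn m w (S.cl w)).card :=
    card_image_le.trans (card_union_le _ _)
  have h2 := card_le_card (S.seenUp_subset (m := m) (z := w) (t := S.cl w))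
  have h3 := card_le_card (S.seenDn_subset (m := m) (z := w) (t := S.cl w))
  have h4 := S.card_seenUp_le (m := m) (z := w) (t := S.cl w)
  have h5 := S.card_seenDn_le (m := m) (z := w) (t := S.cl w)
  omega

end Sweep

/-! ### How the visibility of an edge ends -/

namespace Sweep

variable {n : ℕ} {S : Sweep n} {m : ℕ}

/-- What a fresh pair interrupted by the appearance of `w` looks like. -/
lemma openSlots_spec {w : ℤ} (hw : w ∈ S.arcs) {x y : ℤ} (hy : y < w) (hx : w < x)
    (hv : S.Vis m x y (S.op w)) (hv' : ¬ S.Vis m x y (S.op w + 1))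
    (px : S.Pr x (S.op w + 1)) (py : S.Pr y (S.op w + 1)) :
    |x| ≠ w ∧ |y| ≠ w ∧ w ∉ S.blk x y (S.op w) ∧ (S.blk x y (S.op w)).card + 1 = m := by
  have h0 := ne_zero_of_mem hw
  have h1 := abs_le_of_mem hw
  -- Only the bar `w` changes at this instant, so the arc `w` is the only possible new blocker.
  -- Losing visibility forces it to be one, on top of exactly m - 1 old blockers.
  have hsub : S.blk x y (S.op w + 1) ⊆ insert w (S.blk x y (S.op w)) := by
    intro c hc
    obtain ⟨e1, e2, z, e3, e4, e5, e6⟩ := mem_blk.1 hc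
    by_cases hz : S.Pr z (S.op w)
    · exact mem_insert_of_mem (mem_blk.2 ⟨e1, e2, z, e3, e4, e5, hz⟩)
    · have : z = w := S.single (t := S.op w) (iff_of_false hz (not_not.2 e6))
        (iff_of_false (S.not_pr_op h0 h1) (not_not.2 (S.pr_op h0 h1)))
      rw [← e5, this, abs_of_mem hw]; exact mem_insert_self _ _
  have hcard : m ≤ (S.blk x y (S.op w + 1)).card := by
    by_contra! hlt
    exact hv' ⟨px, py, hv.2.2.1, hv.2.2.2.1, hlt⟩
  have hnot : ¬ S.blk x y (S.op w + 1) ⊆ S.blk x y (S.op w) := by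
    intro h
    have := card_le_card h
    have := hv.2.2.2.2
    omega
  have hwb : w ∈ S.blk x y (S.op w + 1) := by
    by_contra hwb
    refine hnot fun c hc => ?_
    rcases mem_insert.1 (hsub hc) with rfl | h
    · exact absurd hc hwb
    · exact h
  have hwn : w ∉ S.blk x y (S.op w) := by
    intro hwn
    refine hnot fun c hc => ?_
    rcases mem_insert.1 (hsub hc) with rfl | h
    · exact hwn
    · exact h
  obtain ⟨e1, e2, -⟩ := mem_blk.1 hwb
  refine ⟨e1.symm, e2.symm, hwn, ?_⟩
  have h3 := card_le_card hsub
  rw [card_insert_of_notMem hwn] at h3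
  have := hv.2.2.2.2
  omega

/-- Otherwise `Vis.shorten` gives a visible pair of the same arcs nested in the fresh one. With the
analogue on the right, every bar strictly inside a fresh pair belongs to a blocker. -/
lemma Fresh.abs_ne_left {x y z t : ℤ} (hf : S.Fresh m x y t) (hv : S.Vis m x y t) (hy : y < z)
    (hx : z < x) (hz : S.Pr z t) : |z| ≠ |x| := by
  intro e
  have h := hf z y le_rfl hx.le (hv.shorten hx.le le_rfl hy hz hv.2.1 (by rw [e])) (by rw [e])
  omega

lemma Fresh.abs_ne_right {x y z t : ℤ} (hf : S.Fresh m x y t) (hv : S.Vis m x y t) (hy : y < z)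
    (hx : z < x) (hz : S.Pr z t) : |z| ≠ |y| := by
  intro e
  have h := hf x z hy.le le_rfl (hv.shorten le_rfl hy.le hx hv.1 hz (by rw [e])) (by rw [e])
  omega

/-- Two fresh pairs with equally many blockers are not nested. -/
lemma Fresh.not_nested {x y x' y' t : ℤ} (hf : S.Fresh m x y t) (hv : S.Vis m x y t)
    (hv' : S.Vis m x' y' t)
    (hc : (S.blk x y t).card = (S.blk x' y' t).card) (hx : x' ≤ x) (hy : y ≤ y')  :
    x' = x ∧ y' = y := by
  by_contra hne
  have key : ∀ z, y < z → z < x → S.Pr z t → |z| ∈ S.blk x y t := fun z h1 h2 h3 =>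
    mem_blk.2 ⟨hf.abs_ne_left hv h1 h2 h3, hf.abs_ne_right hv h1 h2 h3, z, h1, h2, rfl, h3⟩
  have hlt := hv'.2.2.1
  have hsub : S.blk x' y' t ⊆ S.blk x y t := by
    intro c hc
    obtain ⟨-, -, z, h3, h4, rfl, h6⟩ := mem_blk.1 hc
    exact key z (by omega) (by omega) h6
  -- An end of the inner pair strictly inside the outer pair blocks the outer pair but not the inner
  -- one.
  have : ∃ c ∈ S.blk x y t, c ∉ S.blk x' y' t := by
    by_cases hxx : x' = x
    · have hyy : y' ≠ y := fun h => hne ⟨hxx, h⟩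
      exact ⟨|y'|, key y' (by omega) (by omega) hv'.2.1, fun h => (mem_blk.1 h).2.1 rfl⟩
    · exact ⟨|x'|, key x' (by omega) (by omega) hv'.1, fun h => (mem_blk.1 h).1 rfl⟩
  obtain ⟨c, h1, h2⟩ := this
  have : S.blk x' y' t ⊂ S.blk x y t := (ssubset_iff_of_subset hsub).2 ⟨c, h1, h2⟩
  have := card_lt_card this
  omega

/-- Few edges are interrupted by the appearance of an arc. -/
lemma card_openSlots_le {w : ℤ} (hw : w ∈ S.arcs)
    (hlong : m ≤ (S.up w (S.op w) ∪ S.dn w (S.op w)).card) :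
    (S.openSlots m w).card + (m - (S.up w (S.op w)).card) + (m - (S.dn w (S.op w)).card) ≤ m := by
  have h0 := ne_zero_of_mem hw
  have h1 := abs_le_of_mem hw
  set t := S.op w with ht
  have hch : ∀ s : Sym2 ℤ, ∃ p : ℤ × ℤ, s ∈ S.openSlots m w → s = s(|p.1|, |p.2|) ∧ p.2 < w ∧
      w < p.1 ∧ S.Vis m p.1 p.2 t ∧ ¬ S.Vis m p.1 p.2 (t + 1) ∧
      S.Pr p.1 (t + 1) ∧ S.Pr p.2 (t + 1) ∧ S.Fresh m p.1 p.2 t := by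
    intro s
    by_cases hs : s ∈ S.openSlots m w
    · obtain ⟨-, x, y, h⟩ := mem_filter.1 hs
      exact ⟨(x, y), fun _ => h⟩
    · exact ⟨0, fun h => absurd h hs⟩
  choose f hf using hch
  set X := fun s => (f s).1
  set Y := fun s => (f s).2
  set O := S.openSlots m w
  have hs : ∀ s ∈ O, s = s(|X s|, |Y s|) := fun s h => (hf s h).1
  have hY : ∀ s ∈ O, Y s < w := fun s h => (hf s h).2.1
  have hX : ∀ s ∈ O, w < X s := fun s h => (hf s h).2.2.1
  have hV : ∀ s ∈ O, S.Vis m (X s) (Y s) t := fun s h => (hf s h).2.2.2.1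
  have hF : ∀ s ∈ O, S.Fresh m (X s) (Y s) t := fun s h => (hf s h).2.2.2.2.2.2.2
  have hsp : ∀ s ∈ O, |X s| ≠ w ∧ |Y s| ≠ w ∧ w ∉ S.blk (X s) (Y s) t ∧
      (S.blk (X s) (Y s) t).card + 1 = m := fun s h =>
    openSlots_spec hw (hY s h) (hX s h) (hV s h) (hf s h).2.2.2.2.1 (hf s h).2.2.2.2.2.1
      (hf s h).2.2.2.2.2.2.1
  have hnest : ∀ s ∈ O, ∀ s' ∈ O, X s' ≤ X s → Y s ≤ Y s' → s' = s := by
    intro s h s' h' hx hy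
    have := (hF s h).not_nested (hV s h) (hV s' h')
      (by have := (hsp s h).2.2.2; have := (hsp s' h').2.2.2; omega) hx hy
    rw [hs s h, hs s' h', this.1, this.2]
  have hmU : ∀ s ∈ O, |X s| ∈ S.up w t := fun s h =>
    mem_up.2 ⟨by rw [abs_of_mem hw]; exact (hsp s h).1, X s, hX s h, rfl, (hV s h).1⟩
  have hmD : ∀ s ∈ O, |Y s| ∈ S.dn w t := fun s h =>
    mem_dn.2 ⟨by rw [abs_of_mem hw]; exact (hsp s h).2.1, Y s, hY s h, rfl, (hV s h).2.1⟩
  have hXX : ∀ s ∈ O, ∀ s' ∈ O, X s' < X s → |X s'| ≠ |X s| := fun s h s' h' hlt =>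
    (hF s h).abs_ne_left (hV s h) (by have := hY s h; have := hX s' h'; omega) hlt (hV s' h').1
  have hYY : ∀ s ∈ O, ∀ s' ∈ O, Y s < Y s' → |Y s'| ≠ |Y s| := fun s h s' h' hlt =>
    (hF s h).abs_ne_right (hV s h) hlt (by have := hX s h; have := hY s' h'; omega) (hV s' h').2.1
  have hXi : Set.InjOn (fun s => |X s|) O := by
    intro s h s' h' e
    rcases lt_trichotomy (X s) (X s') with hl | hl | hl
    · exact absurd e (hXX s' h' s h hl)
    · rcases le_total (Y s) (Y s') with hy | hy
      · exact (hnest s h s' h' hl.ge hy).symm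
      · exact hnest s' h' s h hl.le hy
    · exact absurd e.symm (hXX s h s' h' hl)
  have hYi : Set.InjOn (fun s => |Y s|) O := by
    intro s h s' h' e
    rcases lt_trichotomy (Y s) (Y s') with hl | hl | hl
    · exact absurd e.symm (hYY s h s' h' hl)
    · rcases le_total (X s) (X s') with hy | hy
      · exact hnest s' h' s h hy hl.ge
      · exact (hnest s h s' h' hy hl.le).symm
    · exact absurd e (hYY s' h' s h hl)
  have hOU : O.card ≤ (S.up w t).card := card_le_card_of_injOn _ hmU hXi
  have hOD : O.card ≤ (S.dn w t).card := card_le_card_of_injOn _ hmD hYi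
  -- Without interrupted pairs only the deficits remain; they sum to at most m since at least m
  -- other arcs are met.
  rcases O.eq_empty_or_nonempty with hO | hO
  · have := card_union_le (S.up w t) (S.dn w t)
    rw [hO, card_empty]; omega
  -- The pairs are not nested, so `X` and `Y` increase together; `s₁` is the lowest pair. Its m - 1
  -- blockers include the lower arcs of all other pairs, whence |O| ≤ m.
  obtain ⟨s₁, hs₁, hmin⟩ := O.exists_min_image X hO
  have hoth : ∀ s ∈ O.erase s₁, X s₁ < X s ∧ Y s₁ < Y s := by
    intro s h
    obtain ⟨hne, h⟩ := mem_erase.1 h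
    have hx := hmin s h
    have hy : Y s₁ < Y s := by
      by_contra! hy
      exact hne (hnest s h s₁ hs₁ hx hy).symm
    refine ⟨lt_of_le_of_ne hx fun e => ?_, hy⟩
    exact hne (hnest s₁ hs₁ s h e.ge hy.le)
  have hb := hsp s₁ hs₁
  have hOm : O.card ≤ m := by
    have : (O.erase s₁).card ≤ (S.blk (X s₁) (Y s₁) t).card := by
      refine card_le_card_of_injOn (fun s => |Y s|) ?_
        (hYi.mono (by exact_mod_cast erase_subset _ _))
      intro s h
      have h2 := hoth s h
      have h3 := mem_of_mem_erase h
      have h4 := hY s h3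
      have h5 := hX s₁ hs₁
      have h6 := (hV s h3).2.1
      exact mem_blk.2 ⟨(hF s₁ hs₁).abs_ne_left (hV s₁ hs₁) h2.2 (by omega) h6,
        (hF s₁ hs₁).abs_ne_right (hV s₁ hs₁) h2.2 (by omega) h6, Y s, h2.2, by omega, rfl, h6⟩
    rw [card_erase_of_mem hs₁] at this
    omega
  -- Freshness keeps the upper arcs of the other pairs out of `U₁`, while `U₁` and the arcs below
  -- `w` contain the m + 1 arcs of `s₁` and its blockers. Hence |O| ≤ |up| + |dn| - m, which is what
  -- is needed when both sides are deficient.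
  set U₁ := (S.up w t).filter fun c => ∃ z, w < z ∧ z ≤ X s₁ ∧ |z| = c ∧ S.Pr z t with hU₁
  have hU : U₁.card + (O.card - 1) ≤ (S.up w t).card := by
    rw [← card_erase_of_mem hs₁]
    have : (O.erase s₁).card ≤ (S.up w t \ U₁).card := by
      refine card_le_card_of_injOn (fun s => |X s|) ?_
        (hXi.mono (by exact_mod_cast erase_subset _ _))
      intro s h
      have h2 := hoth s h
      have h3 := mem_of_mem_erase h
      refine mem_coe.2 (mem_sdiff.2 ⟨hmU s h3, fun h4 => ?_⟩)
      obtain ⟨-, z, h5, h6, h7, h8⟩ := mem_filter.1 h4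
      have := hY s h3
      exact (hF s h3).abs_ne_left (hV s h3) (by omega) (by omega) h8 h7
    have hsub : U₁ ⊆ S.up w t := filter_subset _ _
    have h6 := card_sdiff_add_card_eq_card hsub
    omega
  have hsub : insert |X s₁| (insert |Y s₁| (S.blk (X s₁) (Y s₁) t)) ⊆ U₁ ∪ S.dn w t := by
    intro c hc
    rcases mem_insert.1 hc with rfl | hc
    · exact mem_union_left _ (mem_filter.2 ⟨hmU s₁ hs₁, X s₁, hX s₁ hs₁, le_rfl, rfl,
        (hV s₁ hs₁).1⟩)
    rcases mem_insert.1 hc with rfl | hc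
    · exact mem_union_right _ (hmD s₁ hs₁)
    have hcw : c ≠ |w| := by rw [abs_of_mem hw]; rintro rfl; exact hb.2.2.1 hc
    obtain ⟨-, -, z, h3, h4, h5, h6⟩ := mem_blk.1 hc
    rcases lt_trichotomy z w with h | h | h
    · exact mem_union_right _ (mem_dn.2 ⟨hcw, z, h, h5, h6⟩)
    · rw [← h5, h] at hcw; exact absurd rfl hcw
    · exact mem_union_left _ (mem_filter.2 ⟨mem_up.2 ⟨hcw, z, h, h5, h6⟩, z, h, h4.le, h5, h6⟩)
  have hc := (card_le_card hsub).trans (card_union_le _ _)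
  rw [card_insert_of_notMem, card_insert_of_notMem] at hc
  · have := card_pos.2 hO
    omega
  · exact fun h => (mem_blk.1 h).2.1 rfl
  · intro h
    rcases mem_insert.1 h with h | h
    · exact (hV s₁ hs₁).2.2.2.1 h
    · exact (mem_blk.1 h).1 rfl

/-- Minimizing `x' - y'` over all visible pairs of the edge and all instants makes the pair fresh.
It cannot stay visible, as `x'` disappears once per turn; take the last instant before the first
loss. -/
lemma Vis.exists_fresh {x y t : ℤ} (h : S.Vis m x y t) : ∃ x' y' t', S.Vis m x' y' t' ∧
    S.Fresh m x' y' t' ∧ s(|x'|, |y'|) = s(|x|, |y|) ∧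
    ¬ S.Vis m x' y' (t' + 1) := by
  obtain ⟨d, hd⟩ : ∃ d : ℕ, ∃ x' y' t', S.Vis m x' y' t' ∧ s(|x'|, |y'|) = s(|x|, |y|) ∧
      x' - y' = d := ⟨(x - y).toNat, x, y, t, h, rfl, by have := h.2.2.1; omega⟩
  have hex : ∃ d : ℕ, ∃ x' y' t', S.Vis m x' y' t' ∧ s(|x'|, |y'|) = s(|x|, |y|) ∧
      x' - y' = d := ⟨d, hd⟩
  obtain ⟨x', y', t₀, h1, h2, h3⟩ := Nat.find_spec hex
  have hmin : ∀ x'' y'' t'', S.Vis m x'' y'' t'' → s(|x''|, |y''|) = s(|x|, |y|) →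
      x' - y' ≤ x'' - y'' := by
    intro x'' y'' t'' e1 e2
    have := Nat.find_min' hex (m := (x'' - y'').toNat)
      ⟨x'', y'', t'', e1, e2, by have := e1.2.2.1; omega⟩
    have := e1.2.2.1
    omega
  have hlost : ∃ j : ℕ, ¬ S.Vis m x' y' (t₀ + j + 1) := by
    by_contra! hall
    have hx0 := S.ne_zero h1.1
    have hxn := S.abs_le h1.1
    have hnp := S.not_pr_cl hx0 hxn
    have hT := S.T_pos
    obtain ⟨i, hi⟩ : ∃ i : ℤ, t₀ + 1 ≤ S.cl x' + 1 + 2 * S.T * i :=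
      ⟨|t₀ - S.cl x'|, by
        have := le_abs_self (t₀ - S.cl x')
        have := abs_nonneg (t₀ - S.cl x')
        nlinarith⟩
    rw [← period i] at hnp
    have := (hall (S.cl x' + 2 * S.T * i - t₀).toNat).1
    rw [Int.toNat_of_nonneg (by omega)] at this
    exact hnp (by convert this using 1; ring)
  have hvis : S.Vis m x' y' (t₀ + (Nat.find hlost : ℕ)) := by
    rcases Nat.eq_zero_or_pos (Nat.find hlost) with h0 | hp
    · rw [h0]; simpa using h1
    · have := Nat.find_min hlost (m := Nat.find hlost - 1) (by omega)
      rw [not_not] at this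
      convert this using 1
      push_cast [Nat.cast_sub hp]; ring
  refine ⟨x', y', _, hvis, ?_, h2, Nat.find_spec hlost⟩
  intro a b h4 h5 h6 h7
  have := hmin a b _ h6 (h7.trans h2)
  omega

/-- `closeSlots` looks at the positive bar at the reference instant `cl`. Full turns, and a half
turn for a negative bar, bring any disappearance there. -/
lemma mk_mem_closeSlots {x y t z : ℤ} (hv : S.Vis m x y t) (hz : z = x ∨ z = y)
    (hp : ¬ S.Pr z (t + 1)) : s(|x|, |y|) ∈ S.closeSlots m |z| := by
  have hpz : S.Pr z t := by rcases hz with rfl | rfl; exacts [hv.1, hv.2.1]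
  -- the case of a bar `z > 0`
  have main : ∀ x y t z : ℤ, S.Vis m x y t → z = x ∨ z = y → ¬ S.Pr z (t + 1) → 0 < z →
      s(|x|, |y|) ∈ S.closeSlots m |z| := by
    intro x y t z hv hz hp h0
    have hpz : S.Pr z t := by rcases hz with rfl | rfl; exacts [hv.1, hv.2.1]
    obtain ⟨i, rfl⟩ := S.cl_unique hpz hp
    rw [vis_period] at hv
    rw [abs_of_pos h0]
    refine mem_image.2 ?_
    rcases hz with rfl | rfl
    · exact ⟨|y|, mem_union_right _ (mem_seenDn.2 ⟨y, rfl, hv⟩), by rw [abs_of_pos h0]⟩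
    · exact ⟨|x|, mem_union_left _ (mem_seenUp.2 ⟨x, rfl, hv⟩), by
        rw [abs_of_pos h0, Sym2.eq_swap]⟩
  rcases lt_or_gt_of_ne (S.ne_zero hpz) with h0 | h0
  · have := main (-y) (-x) (t - S.T) (-z) (by rw [vis_flip]; simpa using hv)
      (by rcases hz with rfl | rfl <;> simp) (by
        rw [S.flip]; convert hp using 2; ring) (by omega)
    rw [abs_neg, abs_neg, abs_neg, Sym2.eq_swap] at this
    exact this
  · exact main x y t z hv hz hp h0

/-- As both bars persist, visibility can only be lost to a bar that appears between them. Up to a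
half turn this bar is positive, and up to full turns it appears at its reference instant `op`. -/
lemma exists_mem_openSlots {x y t : ℤ} (hv : S.Vis m x y t) (hp : ¬ S.Vis m x y (t + 1))
    (px : S.Pr x (t + 1)) (py : S.Pr y (t + 1)) (hf : S.Fresh m x y t) :
    ∃ w ∈ S.arcs, s(|x|, |y|) ∈ S.openSlots m w := by
  obtain ⟨z, h1, h2, h3, h4⟩ : ∃ z, y < z ∧ z < x ∧ S.Pr z (t + 1) ∧ ¬ S.Pr z t := by
    by_contra! hall
    refine hp ⟨px, py, hv.2.2.1, hv.2.2.2.1, lt_of_le_of_lt (card_le_card ?_) hv.2.2.2.2⟩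
    intro c hc
    obtain ⟨e1, e2, z, e3, e4, e5, e6⟩ := mem_blk.1 hc
    exact mem_blk.2 ⟨e1, e2, z, e3, e4, e5, hall z e3 e4 e6⟩
  obtain ⟨i, hi⟩ := S.op_unique h4 h3
  have hmem : ∀ {x y t z i : ℤ}, S.Vis m x y t → ¬ S.Vis m x y (t + 1) → S.Pr x (t + 1) →
      S.Pr y (t + 1) → S.Fresh m x y t → y < z → z < x → t = S.op z + 2 * S.T * i →
      s(|x|, |y|) ∈ S.openSlots m z := by
    intro x y t z i hv hp px py hf h1 h2 hi
    subst hi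
    rw [show S.op z + 2 * S.T * i + 1 = S.op z + 1 + 2 * S.T * i by ring] at hp px py
    rw [vis_period] at hv hp
    rw [period] at px py
    rw [fresh_period] at hf
    exact mem_filter.2 ⟨Finset.mk_mem_sym2_iff.2 ⟨abs_mem_arcs hv.1, abs_mem_arcs hv.2.1⟩,
      x, y, rfl, h1, h2, hv, hp, px, py, hf⟩
  have hz := abs_mem_arcs h3
  rcases lt_or_gt_of_ne (S.ne_zero h3) with h0 | h0
  · refine ⟨-z, by rwa [abs_of_neg h0] at hz, ?_⟩
    have e : t - S.T + 1 + S.T = t + 1 := by ring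
    have e' : t - S.T + S.T = t := by ring
    have hz1 : ¬ S.Pr (-z) (t - S.T) := by rw [S.flip, e']; exact h4
    have hz2 : S.Pr (-z) (t - S.T + 1) := by rw [S.flip, e]; exact h3
    obtain ⟨j, hj⟩ := S.op_unique hz1 hz2
    have := hmem (x := -y) (y := -x) (by rw [vis_flip, e']; exact hv)
      (by rw [vis_flip, e]; exact hp) (by rw [S.flip, e]; exact py) (by rw [S.flip, e]; exact px)
      (by rw [fresh_flip, e']; exact hf) (by omega) (by omega) hj
    rw [abs_neg, abs_neg, Sym2.eq_swap] at this
    exact this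
  · exact ⟨z, by rwa [abs_of_pos h0] at hz, hmem hv hp px py hf h1 h2 hi⟩

/-- Each edge is visible when one of its arcs disappears, or is interrupted by an arc. -/
lemma edges_classify {s : Sym2 ℤ} (hs : s ∈ S.edges m) :
    (∃ w ∈ s, s ∈ S.closeSlots m w) ∨ ∃ w ∈ S.arcs, s ∈ S.openSlots m w := by
  obtain ⟨x, y, t, hv, rfl⟩ := mem_edges.1 hs
  obtain ⟨x, y, t, hv, hf, h, hp⟩ := hv.exists_fresh
  rw [← h]
  by_cases px : S.Pr x (t + 1)
  · by_cases py : S.Pr y (t + 1)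
    · exact Or.inr (exists_mem_openSlots hv hp px py hf)
    · exact Or.inl ⟨|y|, Sym2.mem_mk_right _ _, mk_mem_closeSlots hv (Or.inr rfl) py⟩
  · exact Or.inl ⟨|x|, Sym2.mem_mk_left _ _, mk_mem_closeSlots hv (Or.inl rfl) px⟩

end Sweep

/-! ### The outermost arcs, their gaps, and charging -/

namespace Sweep

variable {n : ℕ} (S : Sweep n) (m : ℕ)

/-- The `m` outermost arcs. -/
def top (_ : Sweep n) (m : ℕ) : Finset ℤ := Ioc ((n : ℤ) - m) n

/-- The outermost arcs below `u` that are met when `u` disappears. -/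
def inner (u : ℤ) : Finset ℤ := (S.top m).filter fun v => v < u ∧ S.Pr v (S.cl u)

/-- The outermost arcs below `u` whose gap contains the gap of `u`. -/
def nested (u : ℤ) : Finset ℤ := (S.top m).filter fun v => v < u ∧ ∀ t, S.Pr v t → S.Pr u t

/-- The arcs above the bar `z`, apart from `u`, `inner u` and the bars of `top`. -/
def above (u z t : ℤ) : Finset ℤ :=
  S.arcs.filter fun c => c ∉ insert u (S.inner m u) ∧ c ≠ |z| ∧
    ∃ y, z < y ∧ y ≤ (n : ℤ) - m ∧ |y| = c ∧ S.Pr y t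

/-- The change of the bar `z` at the instant `t` in the gap of `u` is charged to `u`. -/
def Charged (u z t : ℤ) : Prop :=
  ¬ S.Pr u t ∧ |z| ∉ insert u (S.inner m u) ∧ (S.above m u z t).card ≤ (S.nested m u).card

/-- The edges at `u` whose visibility ends only when `u` disappears. -/
def loose (u : ℤ) : Finset ℤ :=
  S.arcs.filter fun a => a ∉ S.top m ∧ s(u, a) ∈ S.edges m ∧
    (∀ w ∈ S.arcs, w ∉ S.top m → s(u, a) ∉ S.closeSlots m w) ∧
    ∀ w ∈ S.arcs, s(u, a) ∉ S.openSlots m w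

/-- The time of an event: a bar appears (`true`) or disappears (`false`). -/
def time (e : ℤ × Bool) : ℤ := if e.2 then S.op e.1 else S.cl e.1

/-- The events of bars other than those of `top`. -/
def events : Finset (ℤ × Bool) :=
  (S.arcs.image (fun w => -w) ∪ (S.arcs \ S.top m)) ×ˢ univ

/-- The upper of the two bars of an arc that are possibly met. -/
def bar (a t : ℤ) : ℤ := if S.Pr a t then a else -a

variable {S m}

lemma mem_top {u : ℤ} : u ∈ S.top m ↔ (n : ℤ) - m < u ∧ u ≤ n := by simp [top]

lemma card_top : (S.top m).card = m := by
  simp [top]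

lemma top_subset (hmn : m ≤ n) : S.top m ⊆ S.arcs := by
  intro u hu
  rw [mem_top] at hu
  rw [mem_arcs]; omega

lemma mem_inner {u v : ℤ} : v ∈ S.inner m u ↔ v ∈ S.top m ∧ v < u ∧ S.Pr v (S.cl u) := by
  simp [inner]

lemma mem_nested {u v : ℤ} :
    v ∈ S.nested m u ↔ v ∈ S.top m ∧ v < u ∧ ∀ t, S.Pr v t → S.Pr u t := by
  simp [nested]

lemma mem_above {u z t c : ℤ} : c ∈ S.above m u z t ↔ c ∉ insert u (S.inner m u) ∧ c ≠ |z| ∧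
    ∃ y, z < y ∧ y ≤ (n : ℤ) - m ∧ |y| = c ∧ S.Pr y t := by
  simp only [above, mem_filter, and_iff_right_iff_imp]
  rintro ⟨-, -, z, -, -, rfl, h⟩
  exact abs_mem_arcs h

lemma above_period {u z t : ℤ} (i : ℤ) : S.above m u z (t + 2 * S.T * i) = S.above m u z t := by
  simp only [above, period]

lemma charged_period {u z t : ℤ} (i : ℤ) :
    S.Charged m u z (t + 2 * S.T * i) ↔ S.Charged m u z t := by
  simp only [Charged, period, above_period]

lemma pr_cl_of_mem {u : ℤ} (hu : u ∈ S.arcs) : S.Pr u (S.cl u) :=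
  S.pr_cl (ne_zero_of_mem hu) (abs_le_of_mem hu)

lemma not_pr_cl_of_mem {u : ℤ} (hu : u ∈ S.arcs) : ¬ S.Pr u (S.cl u + 1) :=
  S.not_pr_cl (ne_zero_of_mem hu) (abs_le_of_mem hu)

/-- Nothing else changes when `u` disappears. -/
lemma pr_cl_succ {u z : ℤ} (hu : u ∈ S.arcs) (hz : z ≠ u) :
    S.Pr z (S.cl u + 1) ↔ S.Pr z (S.cl u) := by
  by_contra h
  exact hz (S.single (t := S.cl u) (not_iff.1 h).symm
    (iff_of_true (S.pr_cl_of_mem hu) (S.not_pr_cl_of_mem hu)))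

lemma not_pr_of_mem_nested {u v : ℤ} (hu : u ∈ S.arcs) (hv : v ∈ S.nested m u) :
    ¬ S.Pr v (S.cl u) := by
  obtain ⟨-, h1, h2⟩ := mem_nested.1 hv
  rw [← pr_cl_succ hu (by omega)]
  exact fun h => S.not_pr_cl_of_mem hu (h2 _ h)

lemma disjoint_inner_nested {u : ℤ} (hu : u ∈ S.arcs) :
    Disjoint (S.inner m u) (S.nested m u) := by
  rw [Finset.disjoint_left]
  intro v h1 h2
  exact not_pr_of_mem_nested hu h2 (mem_inner.1 h1).2.2

lemma card_inner_add_nested {u : ℤ} (hu : u ∈ S.arcs) (hu' : u ∈ S.top m) :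
    ((S.inner m u).card : ℤ) + (S.nested m u).card ≤ u - ((n : ℤ) - m) - 1 := by
  have h : S.inner m u ∪ S.nested m u ⊆ Ioo ((n : ℤ) - m) u := by
    intro v hv
    rw [mem_Ioo]
    rcases mem_union.1 hv with h | h
    · have := mem_inner.1 h; exact ⟨(mem_top.1 this.1).1, this.2.1⟩
    · have := mem_nested.1 h; exact ⟨(mem_top.1 this.1).1, this.2.1⟩
  have := card_le_card h
  rw [card_union_of_disjoint (disjoint_inner_nested hu), Int.card_Ioo] at this
  have := (mem_top.1 hu').1
  omega

/-- The events charged at an instant are paid by the arcs missing above it. -/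
lemma card_charged_le (hmn : m ≤ n) {z t : ℤ} (hz : |z| ≤ n) :
    ((S.top m).filter fun u => S.Charged m u z t).card ≤ m - (S.up z t).card := by
  set C := (S.top m).filter fun u => S.Charged m u z t with hC
  rcases C.eq_empty_or_nonempty with h | h
  · rw [h]; simp
  obtain ⟨u₀, hu₀, hmin⟩ := C.exists_min_image id h
  simp only [id] at hmin
  obtain ⟨htop, hch⟩ := mem_filter.1 hu₀
  have harc := top_subset hmn htop
  suffices hs : C.card + (S.up z t).card ≤ m by omega
  -- `u₀` is the innermost arc charged. The outermost arcs in `C'` (containing `C`), `P` and `I` are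
  -- disjoint, and `I` contains `nested u₀` and, disjoint from it, `N`. The arcs above `z` lie in
  -- `P`, `above u₀` and `N`, with one exception treated below; since |above| ≤ |nested|, this
  -- leaves room for `C` among the m outermost arcs.
  set C' := (S.top m).filter fun u => u₀ ≤ u ∧ ¬ S.Pr u t ∧ u ≠ |z| with hC'
  set P := (S.top m).filter fun u => u ≠ |z| ∧ S.Pr u t with hP
  set I := (S.top m).filter fun u => u < u₀ ∧ ¬ S.Pr u t with hI
  set N := (S.top m).filter fun u => (u < u₀ ∧ ¬ S.Pr u t) ∧ u ∉ S.nested m u₀ with hN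
  have h1 : C ⊆ C' := by
    intro u hu
    obtain ⟨e1, e2⟩ := mem_filter.1 hu
    refine mem_filter.2 ⟨e1, hmin u hu, e2.1, ?_⟩
    rintro rfl
    exact e2.2.1 (mem_insert_self _ _)
  have hnest : S.nested m u₀ ⊆ I := by
    intro v hv
    obtain ⟨e1, e2, e3⟩ := mem_nested.1 hv
    exact mem_filter.2 ⟨e1, e2, fun h => hch.1 (e3 t h)⟩
  have hNI : N.card + (S.nested m u₀).card ≤ I.card := by
    rw [← card_union_of_disjoint]
    · refine card_le_card (union_subset ?_ hnest)
      intro u hu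
      obtain ⟨e1, e2, e3⟩ := mem_filter.1 hu
      exact mem_filter.2 ⟨e1, e2⟩
    · rw [Finset.disjoint_left]
      intro u hu
      exact (mem_filter.1 hu).2.2
  -- the bars above `z`
  have hup : ∀ c ∈ S.up z t, c ∈ P ∨ c ∈ S.above m u₀ z t ∨ c ∈ N ∨
      (c = u₀ ∧ ¬ S.Pr u₀ t ∧ |z| ∈ S.top m ∧ u₀ < |z|) := by
    intro c hc
    have hca := (mem_filter.1 hc).1
    obtain ⟨e1, y, e2, e3, e4⟩ := mem_up.1 hc
    by_cases hcP : c ∈ P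
    · exact Or.inl hcP
    right
    have hyM : y ≤ (n : ℤ) - m := by
      by_contra! hy
      have hyn := S.abs_le e4
      have hy0 : |y| = y := abs_of_pos (by omega)
      refine hcP (mem_filter.2 ⟨?_, e1, ?_⟩)
      · rw [mem_top]; omega
      · rwa [← e3, hy0]
    by_cases hcu : c = u₀
    · right; right
      have hy : y = -u₀ := by
        rcases abs_choice y with h | h
        · have := mem_top.1 htop; omega
        · omega
      refine ⟨hcu, hch.1, ?_⟩
      have hzneg : |z| = -z := abs_of_neg (by have := mem_arcs.1 harc; omega)
      rw [mem_top]; have := mem_top.1 htop; omega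
    by_cases hcE : c ∈ S.inner m u₀
    · right; left
      obtain ⟨f1, f2, f3⟩ := mem_inner.1 hcE
      refine mem_filter.2 ⟨f1, ⟨f2, fun h => hcP (mem_filter.2 ⟨f1, e1, h⟩)⟩, fun h => ?_⟩
      exact not_pr_of_mem_nested harc h f3
    · left
      exact mem_above.2 ⟨by simp [hcu, hcE], e1, y, e2, hyM, e3, e4⟩
  have hdisj : C'.card + P.card + I.card ≤ ((S.top m).filter fun u => u < u₀ ∨ u ≠ |z|).card := by
    rw [← card_union_of_disjoint, ← card_union_of_disjoint]
    · refine card_le_card fun u hu => ?_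
      rcases mem_union.1 hu with hu | hu
      · rcases mem_union.1 hu with hu | hu
        · have := mem_filter.1 hu; exact mem_filter.2 ⟨this.1, Or.inr this.2.2.2⟩
        · have := mem_filter.1 hu; exact mem_filter.2 ⟨this.1, Or.inr this.2.1⟩
      · have := mem_filter.1 hu; exact mem_filter.2 ⟨this.1, Or.inl this.2.1⟩
    · rw [Finset.disjoint_left]
      intro u hu hu'
      simp only [mem_union, hC', hP, hI, mem_filter] at hu hu'
      rcases hu with hu | hu
      · omega
      · exact hu'.2.2 hu.2.2
    · rw [Finset.disjoint_left]
      intro u hu hu'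
      exact (mem_filter.1 hu).2.2.1 (mem_filter.1 hu').2.2
  have hch3 := hch.2.2
  have hcc := card_le_card h1
  -- `u₀` can lie above `z` only through its bar `-u₀`. Then |z| is an outermost arc beyond `u₀`
  -- that belongs to none of the three classes, which makes room for `u₀`.
  by_cases hq : |z| ∈ S.top m ∧ u₀ < |z|
  · have hsub : S.up z t ⊆ insert u₀ (P ∪ (S.above m u₀ z t ∪ N)) := by
      intro c hc
      rw [mem_insert, mem_union, mem_union]
      rcases hup c hc with h | h | h | h
      exacts [Or.inr (Or.inl h), Or.inr (Or.inr (Or.inl h)), Or.inr (Or.inr (Or.inr h)), Or.inl h.1]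
    have e1 := (card_le_card hsub).trans (card_insert_le _ _)
    have e2 := card_union_le P (S.above m u₀ z t ∪ N)
    have e3 := card_union_le (S.above m u₀ z t) N
    have e4 : ((S.top m).filter fun u => u < u₀ ∨ u ≠ |z|) ⊆ (S.top m).erase |z| := by
      intro u hu
      obtain ⟨f1, f2⟩ := mem_filter.1 hu
      refine mem_erase.2 ⟨?_, f1⟩
      rcases f2 with f2 | f2
      · omega
      · exact f2
    have e5 := card_le_card e4
    rw [card_erase_of_mem hq.1, card_top] at e5
    have : 0 < (S.top m).card := card_pos.2 ⟨_, htop⟩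
    rw [card_top] at this
    omega
  · have hsub : S.up z t ⊆ P ∪ (S.above m u₀ z t ∪ N) := by
      intro c hc
      rw [mem_union, mem_union]
      rcases hup c hc with h | h | h | h
      exacts [Or.inl h, Or.inr (Or.inl h), Or.inr (Or.inr h), absurd h.2.2 hq]
    have e1 := card_le_card hsub
    have e2 := card_union_le P (S.above m u₀ z t ∪ N)
    have e3 := card_union_le (S.above m u₀ z t) N
    have e4 := card_filter_le (S.top m) fun u => u < u₀ ∨ u ≠ |z|
    rw [card_top] at e4
    omega

lemma exists_step {P : ℤ → Prop} {a b : ℤ} (hab : a ≤ b) (ha : P a) (hb : ¬ P b) :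
    ∃ t, a ≤ t ∧ t < b ∧ (∀ s, a ≤ s → s ≤ t → P s) ∧ ¬ P (t + 1) := by
  have hex : ∃ j : ℕ, ¬ P (a + j) := ⟨(b - a).toNat, by
    rw [Int.toNat_of_nonneg (by omega)]; convert hb using 2; ring⟩
  have h1 := Nat.find_spec hex
  have h2 : Nat.find hex ≤ (b - a).toNat := Nat.find_min' hex (by
    rw [Int.toNat_of_nonneg (by omega)]; convert hb using 2; ring)
  have h0 : Nat.find hex ≠ 0 := by
    intro h
    rw [h] at h1
    exact h1 (by simpa using ha)
  refine ⟨a + Nat.find hex - 1, by omega, by omega, ?_, by convert h1 using 2; ring⟩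
  intro s h3 h4
  have := Nat.find_min hex (m := (s - a).toNat) (by omega)
  rw [not_not, Int.toNat_of_nonneg (by omega)] at this
  convert this using 1; ring

lemma eq_of_period {a i : ℤ} {t : ℤ} (h1 : t = a + 2 * S.T * i) (h2 : a < t)
    (h3 : t < a + 2 * S.T) : False := by
  have hT := S.T_pos
  have : 0 < i := by by_contra! h; nlinarith
  have : i < 1 := by by_contra! h; nlinarith
  omega

/-- The gap of an arc. -/
lemma exists_gap {u : ℤ} (hu : u ∈ S.arcs) : ∃ q, S.cl u < q ∧ q < S.cl u + 2 * S.T ∧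
    (∀ t, S.cl u < t → t ≤ q → ¬ S.Pr u t) ∧ ∀ t, q < t → t ≤ S.cl u + 2 * S.T → S.Pr u t := by
  have hT := S.T_pos
  have hp := S.pr_cl_of_mem hu
  obtain ⟨q, h1, h2, h3, h4⟩ := exists_step (P := fun t => ¬ S.Pr u t) (a := S.cl u + 1)
    (b := S.cl u + 2 * S.T) (by omega) (S.not_pr_cl_of_mem hu)
    (by rw [not_not, period_one]; exact hp)
  rw [not_not] at h4
  refine ⟨q, by omega, by omega, fun t e1 e2 => h3 t (by omega) e2, fun t e1 e2 => ?_⟩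
  by_contra hn
  -- A second disappearance of `u` strictly within a turn contradicts `cl_unique`.
  obtain ⟨r, f1, f2, f3, f4⟩ := exists_step (P := fun t => S.Pr u t) (a := q + 1) (b := t)
    (by omega) h4 hn
  obtain ⟨i, hi⟩ := S.cl_unique (f3 r f1 le_rfl) f4
  exact eq_of_period hi (by omega) (by omega)

/-- The alternative for two of the outermost arcs. -/
lemma mem_inner_or_nested (hmn : m ≤ n) {u v : ℤ} (hu : u ∈ S.top m) (hv : v ∈ S.top m)
    (hvu : v < u) (h : S.Pr u (S.op v)) : v ∈ S.inner m u ∨ v ∈ S.nested m u := by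
  by_contra! hno
  have hua := top_subset hmn hu
  have h1 : ¬ S.Pr v (S.cl u) := fun h => hno.1 (mem_inner.2 ⟨hv, hvu, h⟩)
  obtain ⟨t, h2, h3⟩ : ∃ t, S.Pr v t ∧ ¬ S.Pr u t := by
    by_contra! hall
    exact hno.2 (mem_nested.2 ⟨hv, hvu, hall⟩)
  have hT := S.T_pos
  -- Move the instant into the turn that begins when `u` disappears. There `v` is absent at first
  -- and appears while `u` is met, yet `u` is absent at `t'`: it would disappear a second time
  -- within the turn.
  set t' := S.cl u + 1 + (t - (S.cl u + 1)) % (2 * S.T) with ht'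
  obtain ⟨i, hi⟩ : ∃ i : ℤ, t = t' + 2 * S.T * i :=
    ⟨(t - (S.cl u + 1)) / (2 * S.T), by
      have := Int.emod_add_mul_ediv (t - (S.cl u + 1)) (2 * S.T)
      omega⟩
  have h4 := Int.emod_nonneg (t - (S.cl u + 1)) (b := 2 * S.T) (by omega)
  have h5 := Int.emod_lt_of_pos (t - (S.cl u + 1)) (b := 2 * S.T) (by omega)
  rw [hi, period] at h2 h3
  rw [← pr_cl_succ hua (by omega)] at h1
  obtain ⟨s, e1, e2, e3, e4⟩ := exists_step (P := fun t => ¬ S.Pr v t) (a := S.cl u + 1) (b := t')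
    (by omega) h1 (by rwa [not_not])
  rw [not_not] at e4
  obtain ⟨j, hj⟩ := S.op_unique (e3 s e1 le_rfl) e4
  rw [← period j, ← hj] at h
  obtain ⟨r, f1, f2, f3, f4⟩ := exists_step (P := fun t => S.Pr u t) (a := s) (b := t')
    (by omega) h h3
  obtain ⟨l, hl⟩ := S.cl_unique (f3 r f1 le_rfl) f4
  exact eq_of_period hl (by omega) (by omega)

end Sweep

/-! ### Loose edges persist until the outermost arc disappears -/

namespace Sweep

variable {n : ℕ} {S : Sweep n} {m : ℕ}

lemma abs_bar {a t : ℤ} (ha : a ∈ S.arcs) : |S.bar a t| = a := by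
  unfold bar; split_ifs
  · exact abs_of_mem ha
  · rw [abs_neg]; exact abs_of_mem ha

lemma bar_le {a t : ℤ} (ha : a ∈ S.arcs) : S.bar a t ≤ a := by
  have := mem_arcs.1 ha
  unfold bar; split_ifs <;> omega

lemma neg_le_bar {a t : ℤ} (ha : a ∈ S.arcs) : -a ≤ S.bar a t := by
  have := mem_arcs.1 ha
  unfold bar; split_ifs <;> omega

/-- No bar of `a` is above `bar a`. -/
lemma le_bar {a t y : ℤ} (ha : a ∈ S.arcs) (h : S.Pr y t) (hy : |y| = a) : y ≤ S.bar a t := by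
  have := mem_arcs.1 ha
  rcases abs_choice y with h' | h'
  · have : y = a := by omega
    subst this
    simp [bar, h]
  · have := neg_le_bar (S := S) (t := t) ha; omega

lemma pr_bar {a t y : ℤ} (h : S.Pr y t) (hy : |y| = a) : S.Pr (S.bar a t) t := by
  unfold bar; split_ifs with h'
  · exact h'
  · rcases abs_choice y with e | e
    · exact absurd (by rwa [← hy, e]) h'
    · rwa [show -a = y by omega]

lemma bar_period {a t : ℤ} (i : ℤ) : S.bar a (t + 2 * S.T * i) = S.bar a t := by
  simp only [bar, period]

lemma mem_loose {u a : ℤ} : a ∈ S.loose m u ↔ a ∈ S.arcs ∧ a ∉ S.top m ∧ s(u, a) ∈ S.edges m ∧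
    (∀ w ∈ S.arcs, w ∉ S.top m → s(u, a) ∉ S.closeSlots m w) ∧
    ∀ w ∈ S.arcs, s(u, a) ∉ S.openSlots m w := by
  simp [loose]

lemma le_of_mem_loose {u a : ℤ} (ha : a ∈ S.loose m u) : a ≤ (n : ℤ) - m := by
  obtain ⟨h1, h2, -⟩ := mem_loose.1 ha
  rw [mem_top] at h2
  rw [mem_arcs] at h1
  omega

lemma notMem_of_mem_loose {u a : ℤ} (ha : a ∈ S.loose m u) (hu : u ∈ S.top m) :
    a ∉ insert u (S.inner m u) := by
  obtain ⟨h1, h2, -⟩ := mem_loose.1 ha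
  rw [mem_insert, mem_inner]
  rintro (rfl | h)
  · exact h2 hu
  · exact h2 h.1

/-- A loose edge stays visible until `u` disappears. -/
lemma vis_bar_succ (hmn : m ≤ n) {u a t : ℤ} (hu : u ∈ S.top m) (ha : a ∈ S.loose m u)
    (hv : S.Vis m u (S.bar a t) t) (hp : S.Pr u (t + 1)) :
    S.Vis m u (S.bar a (t + 1)) (t + 1) ∧ S.bar a t ≤ S.bar a (t + 1) := by
  obtain ⟨h1, h2, -, h3, h4⟩ := mem_loose.1 ha
  have hM := le_of_mem_loose ha
  have hua := top_subset hmn hu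
  have hu' := mem_top.1 hu
  have e1 : |u| = u := abs_of_mem hua
  have e2 : |S.bar a t| = a := abs_bar h1
  have hpb : S.Pr (S.bar a t) (t + 1) := by
    by_contra hn
    have := mk_mem_closeSlots hv (Or.inr rfl) hn
    rw [e1, e2] at this
    exact h3 a h1 h2 this
  -- No bar of `a` is above `bar a t`, and `-u` is below both bars of `a` because a ≤ n - m < u. So
  -- no other pair of the same arcs is nested inside.
  have hf : S.Fresh m u (S.bar a t) t := by
    intro x y hy hx hxy hs
    have hlt := hxy.2.2.1
    have hge := neg_le_bar (S := S) (t := t) h1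
    rw [e1, e2, Sym2.eq_iff] at hs
    rcases hs with ⟨f1, f2⟩ | ⟨f1, f2⟩
    · have := le_bar h1 hxy.2.1 f2
      rcases abs_choice x with h | h <;> omega
    · rcases abs_choice y with h | h <;> omega
  have hv1 : S.Vis m u (S.bar a t) (t + 1) := by
    by_contra hn
    obtain ⟨w, hw, hs⟩ := exists_mem_openSlots hv hn hp hpb hf
    rw [e1, e2] at hs
    exact h4 w hw hs
  have hle := le_bar h1 hpb e2
  have h5 := bar_le (S := S) (t := t + 1) h1
  refine ⟨hv1.shorten le_rfl hle (by omega) hp (pr_bar hpb e2) ?_, hle⟩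
  rw [abs_bar h1, abs_bar h1]

/-- A loose neighbour of `u` does not persist during the gap of `u` in a position where `u` sees
it afterwards. -/
lemma not_persist (hmn : m ≤ n) {u a y q : ℤ} (hu : u ∈ S.top m) (ha : a ∈ S.loose m u)
    (hq : S.cl u < q) (hq' : q < S.cl u + 2 * S.T)
    (hgap : ∀ t, S.cl u < t → t ≤ q → ¬ S.Pr u t)
    (hint : ∀ t, q < t → t ≤ S.cl u + 2 * S.T → S.Pr u t)
    (hgood : ∀ t, S.cl u ≤ t → t ≤ q + 1 → S.bar a t = y ∧ S.Pr y t ∧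
      (S.above m u y t).card ≤ (S.nested m u).card) : False := by
  obtain ⟨h1, h2, -, h3, h4⟩ := mem_loose.1 ha
  have hM := le_of_mem_loose ha
  have hua := top_subset hmn hu
  have hu' := mem_top.1 hu
  have hg1 := hgood (q + 1) (by omega) le_rfl
  have hg0 := hgood (S.cl u) le_rfl (by omega)
  have e2 : |y| = a := by rw [← hg0.1]; exact abs_bar h1
  have hya : y ≤ a := by rw [← e2]; exact le_abs_self y
  -- `u` sees `a` when it reappears
  have hvis : S.Vis m u (S.bar a (q + 1)) (q + 1) := by
    rw [hg1.1]
    refine ⟨hint _ (by omega) (by omega), hg1.2.1, by omega, ?_, ?_⟩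
    · rw [abs_of_mem hua, e2]; omega
    -- A nested arc is absent at `q` and cannot appear at the same instant as `u`. So the blockers
    -- are non-nested outermost arcs below `u`, or arcs of `above`; as |above| ≤ |nested|, there are
    -- at most u - (n - m) - 1 < m of them.
    have hsub : S.blk u y (q + 1) ⊆
        (Ioo ((n : ℤ) - m) u \ S.nested m u) ∪ S.above m u y (q + 1) := by
      intro c hc
      obtain ⟨f1, f2, z, f3, f4, f5, f6⟩ := mem_blk.1 hc
      rw [abs_of_mem hua] at f1
      have hzn := S.abs_le f6
      by_cases hz : z ≤ (n : ℤ) - m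
      · by_cases hcI : c ∈ S.inner m u
        · have hcI' := mem_inner.1 hcI
          refine mem_union_left _ (mem_sdiff.2 ⟨mem_Ioo.2 ⟨(mem_top.1 hcI'.1).1, hcI'.2.1⟩, ?_⟩)
          exact Finset.disjoint_left.1 (disjoint_inner_nested hua) hcI
        · exact mem_union_right _ (mem_above.2 ⟨by simp [f1, hcI], f2, z, f3, hz, f5, f6⟩)
      · have hc : c = z := by rw [← f5]; exact abs_of_pos (by omega)
        subst hc
        refine mem_union_left _ (mem_sdiff.2 ⟨mem_Ioo.2 ⟨by omega, f4⟩, fun hcN => ?_⟩)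
        have hnu := hgap q hq le_rfl
        have hnc : ¬ S.Pr c q := fun h => hnu ((mem_nested.1 hcN).2.2 _ h)
        have hpu := hint (q + 1) (by omega) (by omega)
        exact f1 (S.single (t := q) (iff_of_false hnc (not_not.2 f6))
          (iff_of_false hnu (not_not.2 hpu)))
    have hNsub : S.nested m u ⊆ Ioo ((n : ℤ) - m) u := by
      intro v hv
      have := mem_nested.1 hv
      exact mem_Ioo.2 ⟨(mem_top.1 this.1).1, this.2.1⟩
    have f1 := (card_le_card hsub).trans (card_union_le _ _)
    have f2 := card_sdiff_add_card_eq_card hNsub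
    rw [Int.card_Ioo] at f2
    have := hg1.2.2
    omega
  have hfollow : ∀ j : ℕ, q + 1 + j ≤ S.cl u + 2 * S.T →
      S.Vis m u (S.bar a (q + 1 + j)) (q + 1 + j) := by
    intro j
    induction j with
    | zero => intro _; simpa using hvis
    | succ j ih =>
      intro hj
      push_cast at hj ⊢
      have := (vis_bar_succ hmn hu ha (ih (by omega)) (hint _ (by omega) (by omega))).1
      rwa [add_assoc] at this
  -- While `u` is met, the upper bar of `a` can only rise. It equals `y` at q + 1 and again a full
  -- turn after `cl u`, so it is always `y`. Then `y` is present for a whole turn, although every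
  -- bar disappears once.
  have hmono : ∀ j : ℕ, ∀ i : ℕ, q + 1 + (i + j : ℕ) ≤ S.cl u + 2 * S.T →
      S.bar a (q + 1 + i) ≤ S.bar a (q + 1 + (i + j : ℕ)) := by
    intro j i
    induction j with
    | zero => intro _; simp
    | succ j ih =>
      intro hj
      push_cast at hj ih ⊢
      have := (vis_bar_succ hmn hu ha (hfollow (i + j) (by push_cast; omega))
        (hint _ (by push_cast; omega) (by push_cast; omega))).2
      push_cast at this
      have h5 := ih (by omega)
      rw [show q + 1 + ((i : ℤ) + (j + 1)) = q + 1 + (i + j) + 1 by ring]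
      omega
  have hpr : ∀ t, S.cl u ≤ t → t ≤ S.cl u + 2 * S.T → S.Pr y t := by
    intro t f1 f2
    rcases le_or_gt t (q + 1) with f3 | f3
    · exact (hgood t f1 f3).2.1
    obtain ⟨i, hi⟩ : ∃ i : ℕ, t = q + 1 + i := ⟨(t - (q + 1)).toNat, by omega⟩
    obtain ⟨j, hj⟩ : ∃ j : ℕ, S.cl u + 2 * S.T = t + j := ⟨(S.cl u + 2 * S.T - t).toNat, by omega⟩
    have g1 := hmono i 0 (by push_cast; omega)
    have g2 := hmono j i (by push_cast; omega)
    have g3 := hfollow i (by omega)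
    simp only [Nat.cast_zero, add_zero, zero_add] at g1
    rw [hg1.1, ← hi] at g1
    rw [← hi, show q + 1 + ((i + j : ℕ) : ℤ) = S.cl u + 2 * S.T * 1 by push_cast; omega, bar_period,
      hg0.1] at g2
    rw [← hi, le_antisymm g2 g1] at g3
    exact g3.2.1
  have hT := S.T_pos
  have h5 := Int.emod_nonneg (S.cl y - S.cl u) (b := 2 * S.T) (by omega)
  have h6 := Int.emod_lt_of_pos (S.cl y - S.cl u) (b := 2 * S.T) (by omega)
  have h7 := Int.emod_add_mul_ediv (S.cl y - S.cl u) (2 * S.T)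
  have h8 := S.not_pr_cl (S.ne_zero hg0.2.1) (S.abs_le hg0.2.1)
  refine h8 ?_
  have h9 := hpr (S.cl u + (S.cl y - S.cl u) % (2 * S.T) + 1) (by omega) (by omega)
  rw [← period ((S.cl y - S.cl u) / (2 * S.T))] at h9
  convert h9 using 1
  linarith

/-- The way in which a persisting neighbour is lost. -/
lemma exists_event_of_lost {u a y t : ℤ} (haa : a ∈ S.arcs) (hM : a ≤ (n : ℤ) - m)
    (haE : a ∉ insert u (S.inner m u)) (hb : S.bar a t = y) (hy : S.Pr y t)
    (hc : (S.above m u y t).card ≤ (S.nested m u).card)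
    (hn : ¬ (S.bar a (t + 1) = y ∧ S.Pr y (t + 1) ∧
      (S.above m u y (t + 1)).card ≤ (S.nested m u).card)) :
    ∃ z, z ≤ (n : ℤ) - m ∧ (S.Pr z t ↔ ¬ S.Pr z (t + 1)) ∧ |z| ≤ n ∧
      |z| ∉ insert u (S.inner m u) ∧ (S.above m u z t).card ≤ (S.nested m u).card ∧
      (|z| = a ∨ (|z| ∉ S.above m u y t ∧ (S.nested m u).card ≤ (S.above m u y t).card)) := by
  have e2 : |y| = a := by rw [← hb]; exact abs_bar haa
  have hya : y ≤ a := by rw [← e2]; exact le_abs_self y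
  have ha1 := mem_arcs.1 haa
  have hsub : ∀ z, y < z → S.above m u z t ⊆ S.above m u y t := by
    intro z hz c hcz
    obtain ⟨f1, f2, x, f3, f4, f5, f6⟩ := mem_above.1 hcz
    refine mem_above.2 ⟨f1, ?_, x, by omega, f4, f5, f6⟩
    rw [e2]
    rintro rfl
    have := le_bar haa f6 f5
    omega
  -- Three events are possible: `y` disappears; the bar `a` appears and replaces `-a`; or a new arc
  -- enters `above`, whose size had already reached that of `nested`. The final disjunction records
  -- which, for the injectivity of the charging.
  by_cases py : S.Pr y (t + 1)
  swap
  · exact ⟨y, by omega, iff_of_true hy py, S.abs_le hy, by rwa [e2], hc, Or.inl e2⟩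
  by_cases hb' : S.bar a (t + 1) = y
  swap
  · have hle := le_bar haa py e2
    have hpa : S.Pr a (t + 1) := by
      by_contra hpa
      have : S.bar a (t + 1) = -a := by simp [bar, hpa]
      rcases abs_choice y with h | h <;> omega
    have hba : S.bar a (t + 1) = a := by simp [bar, hpa]
    have hpa' : ¬ S.Pr a t := by
      intro h
      have : S.bar a t = a := by simp [bar, h]
      omega
    refine ⟨a, hM, iff_of_false hpa' (not_not.2 hpa),
      by rw [abs_of_mem haa]; exact ha1.2, by rwa [abs_of_mem haa], ?_,
      Or.inl (abs_of_mem haa)⟩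
    exact (card_le_card (hsub a (by omega))).trans hc
  have hcard : (S.nested m u).card < (S.above m u y (t + 1)).card := by
    by_contra! h; exact hn ⟨hb', py, h⟩
  obtain ⟨c, hc1, hc2⟩ : ∃ c ∈ S.above m u y (t + 1), c ∉ S.above m u y t := by
    by_contra! h
    have := card_le_card h
    omega
  obtain ⟨f1, f2, z, f3, f4, f5, f6⟩ := mem_above.1 hc1
  have f7 : ¬ S.Pr z t := fun h => hc2 (mem_above.2 ⟨f1, f2, z, f3, f4, f5, h⟩)
  have hins : S.above m u y (t + 1) ⊆ insert c (S.above m u y t) := by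
    intro d hd
    obtain ⟨g1, g2, x, g3, g4, g5, g6⟩ := mem_above.1 hd
    by_cases hx : S.Pr x t
    · exact mem_insert_of_mem (mem_above.2 ⟨g1, g2, x, g3, g4, g5, hx⟩)
    · have : x = z := S.single (t := t) (iff_of_false hx (not_not.2 g6))
        (iff_of_false f7 (not_not.2 f6))
      rw [← g5, this, f5]; exact mem_insert_self _ _
  have h8 := (card_le_card hins).trans (card_insert_le _ _)
  refine ⟨z, f4, iff_of_false f7 (not_not.2 f6), S.abs_le f6, by rwa [f5],
    (card_le_card (hsub z f3)).trans hc,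
    Or.inr ⟨by rwa [f5], by omega⟩⟩

end Sweep

/-! ### Counting loose edges -/

namespace Sweep

variable {n : ℕ} {S : Sweep n} {m : ℕ}

lemma card_le_card_up_union_dn {w t : ℤ} (hw : w ∈ S.arcs)
    (hlong : m + 1 ≤ (S.line t).card) : m ≤ (S.up w t ∪ S.dn w t).card := by
  have hsub : S.line t ⊆ insert w (S.up w t ∪ S.dn w t) := by
    intro c hc
    obtain ⟨h1, h2⟩ := mem_filter.1 hc
    have hc1 := mem_arcs.1 h1
    have hw1 := mem_arcs.1 hw
    rw [mem_insert, mem_union, mem_up, mem_dn, abs_of_mem hw]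
    by_cases hcw : c = w
    · exact Or.inl hcw
    · right
      rcases h2 with h2 | h2
      · rcases lt_or_gt_of_ne hcw with h | h
        · exact Or.inr ⟨hcw, c, h, abs_of_mem h1, h2⟩
        · exact Or.inl ⟨hcw, c, h, abs_of_mem h1, h2⟩
      · exact Or.inr ⟨hcw, -c, by omega, by rw [abs_neg, abs_of_mem h1], h2⟩
  have := (card_le_card hsub).trans (card_insert_le _ _)
  omega

lemma mem_events {z : ℤ} {b : Bool} (h0 : z ≠ 0) (hn : |z| ≤ n) (hM : z ≤ (n : ℤ) - m) :
    (z, b) ∈ S.events m := by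
  refine mem_product.2 ⟨?_, mem_univ _⟩
  rcases lt_or_gt_of_ne h0 with h | h
  · refine mem_union_left _ (mem_image.2 ⟨-z, ?_, neg_neg z⟩)
    rw [abs_of_neg h] at hn
    rw [mem_arcs]; omega
  · refine mem_union_right _ (mem_sdiff.2 ⟨?_, ?_⟩)
    · rw [abs_of_pos h] at hn
      rw [mem_arcs]; omega
    · rw [mem_top]; omega

/-- By `edges_classify` a loose edge must be visible when `u` disappears. As a ≤ n - m < u, no bar
of `a` lies above `u`. -/
lemma loose_subset_seenDn {u : ℤ} (hu : u ∈ S.top m) :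
    S.loose m u ⊆ S.seenDn m u (S.cl u) := by
  intro a ha
  obtain ⟨h1, h2, h0, h3, h4⟩ := mem_loose.1 ha
  have hM := le_of_mem_loose ha
  have hu' := mem_top.1 hu
  rcases edges_classify h0 with ⟨w, hw, hs⟩ | ⟨w, hw, hs⟩
  · rw [Sym2.mem_iff] at hw
    rcases hw with rfl | rfl
    · obtain ⟨b, hb, e⟩ := mem_image.1 hs
      rw [Sym2.congr_right] at e
      subst e
      rcases mem_union.1 hb with h | h
      · exfalso
        obtain ⟨y, h5, h6⟩ := mem_seenUp.1 h
        have := h6.2.2.1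
        have := le_abs_self y
        omega
      · exact h
    · exact absurd hs (h3 w h1 h2)
  · exact absurd hs (h4 w hw)

/-- The number of loose edges at `u` lost in the gap of `u`. -/
lemma card_loose_inter_le (hmn : m ≤ n) {u : ℤ} (hu : u ∈ S.top m) {A : Finset ℤ}
    (hA : ∀ a ∈ A, a ∈ S.loose m u → S.Pr (S.bar a (S.cl u)) (S.cl u) ∧
      (S.above m u (S.bar a (S.cl u)) (S.cl u)).card ≤ (S.nested m u).card) :
    (S.loose m u ∩ A).card ≤
      ((S.events m).filter fun e => S.Charged m u e.1 (S.time e)).card := by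
  have hua := top_subset hmn hu
  have hu' := mem_top.1 hu
  have hT := S.T_pos
  obtain ⟨q, hq, hq', hgap, hint⟩ := exists_gap hua
  set p := S.cl u with hp
  have hex : ∀ a, ∃ t z : ℤ, a ∈ S.loose m u ∩ A → p < t ∧ t ≤ q ∧
      (S.bar a t = S.bar a p ∧ S.Pr (S.bar a p) t ∧
        (S.above m u (S.bar a p) t).card ≤ (S.nested m u).card) ∧
      z ≤ (n : ℤ) - m ∧ (S.Pr z t ↔ ¬ S.Pr z (t + 1)) ∧ |z| ≤ n ∧ S.Charged m u z t ∧
      (|z| = a ∨ (|z| ∉ S.above m u (S.bar a p) t ∧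
        (S.nested m u).card ≤ (S.above m u (S.bar a p) t).card)) := by
    intro a
    by_cases ha : a ∈ S.loose m u ∩ A
    swap
    · exact ⟨0, 0, fun h => absurd h ha⟩
    obtain ⟨haL, haA⟩ := mem_inter.1 ha
    have haE := notMem_of_mem_loose haL hu
    have hM := le_of_mem_loose haL
    set Good : ℤ → Prop := fun t => S.bar a t = S.bar a p ∧ S.Pr (S.bar a p) t ∧
      (S.above m u (S.bar a p) t).card ≤ (S.nested m u).card with hGood
    obtain ⟨b, hb1, hb2, hb3⟩ : ∃ b, p ≤ b ∧ b ≤ q + 1 ∧ ¬ Good b := by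
      by_contra! hall
      exact not_persist hmn hu haL hq hq' hgap hint hall
    obtain ⟨t, h1, h2, h3, h4⟩ := exists_step (P := Good) hb1 ⟨rfl, hA a haA haL⟩ hb3
    have hg := h3 t h1 le_rfl
    obtain ⟨z, e1, e2, e3, e4, e5, e6⟩ :=
      exists_event_of_lost (mem_loose.1 haL).1 hM haE hg.1 hg.2.1
      hg.2.2 h4
    -- At `p` only the bar `u` changes, whereas z ≤ n - m < u.
    have hpt : p < t := by
      refine lt_of_le_of_ne h1 ?_
      rintro rfl
      have := S.single e2 (iff_of_true (S.pr_cl_of_mem hua) (S.not_pr_cl_of_mem hua))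
      omega
    exact ⟨t, z, fun _ => ⟨hpt, by omega, hg, e1, e2, e3, ⟨hgap t hpt (by omega), e4, e5⟩, e6⟩⟩
  choose τ z hτ using hex
  have hev : ∀ a ∈ S.loose m u ∩ A, ∃ i : ℤ,
      τ a = S.time (z a, decide (S.Pr (z a) (τ a + 1))) + 2 * S.T * i := by
    intro a ha
    obtain ⟨-, -, -, -, h5, -⟩ := hτ a ha
    by_cases h : S.Pr (z a) (τ a + 1)
    · simpa [time, h] using S.op_unique (fun h' => (h5.1 h') h) h
    · simpa [time, h] using S.cl_unique (h5.2 h) h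
  refine card_le_card_of_injOn (fun a => (z a, decide (S.Pr (z a) (τ a + 1)))) ?_ ?_
  · intro a ha
    obtain ⟨h1, h2, h3, h4, h5, h6, h7, -⟩ := hτ a ha
    obtain ⟨i, hi⟩ := hev a ha
    refine mem_coe.2 (mem_filter.2 ⟨mem_events ?_ h6 h4, ?_⟩)
    · by_cases h : S.Pr (z a) (τ a)
      · exact S.ne_zero h
      · exact S.ne_zero (t := τ a + 1) (by by_contra h'; exact h (h5.2 h'))
    · rw [hi, charged_period] at h7
      exact h7
  · intro a ha b hb hab
    simp only at hab
    obtain ⟨i, hi⟩ := hev a ha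
    obtain ⟨j, hj⟩ := hev b hb
    rw [← hab] at hj
    obtain ⟨h1, h2, h3, h4, h5, h6, h7, h8⟩ := hτ a ha
    obtain ⟨k1, k2, k3, k4, k5, k6, k7, k8⟩ := hτ b hb
    -- Both instants lie in the gap of `u`, which is shorter than a turn, so the event determines
    -- the instant.
    have ht : τ a = τ b := by
      have hij : τ a - τ b = 2 * S.T * (i - j) := by rw [mul_sub]; omega
      have h : i - j < 1 := by by_contra! h; nlinarith
      have h' : -1 < i - j := by by_contra! h; nlinarith
      have : i - j = 0 := by omega
      rw [this] at hij; omega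
    have hz : z a = z b := congrArg Prod.fst hab
    -- Suppose two neighbours share an event and `a` is the upper one. It has fewer than |nested u|
    -- arcs above it, so the event is one of the arc `a`. But `a` differs from `b` and is already
    -- above it, so this event cannot be the one that disturbs `b`.
    have key : ∀ a b t z, a ∈ S.loose m u ∩ A → b ∈ S.loose m u ∩ A →
        S.bar a t = S.bar a p → S.bar b t = S.bar b p → S.Pr (S.bar a p) t →
        (S.above m u (S.bar b p) t).card ≤ (S.nested m u).card →
        (|z| = a ∨ (|z| ∉ S.above m u (S.bar a p) t ∧
          (S.nested m u).card ≤ (S.above m u (S.bar a p) t).card)) →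
        (|z| = b ∨ (|z| ∉ S.above m u (S.bar b p) t ∧
          (S.nested m u).card ≤ (S.above m u (S.bar b p) t).card)) →
        ¬ S.bar b p < S.bar a p := by
      intro a b t z ha hb e1 e2 e3 e4 e5 e6 hlt
      have haL := (mem_inter.1 ha).1
      have hbL := (mem_inter.1 hb).1
      have haa := (mem_loose.1 haL).1
      have hba := (mem_loose.1 hbL).1
      have hba' : |S.bar b p| = b := abs_bar hba
      have haa' : |S.bar a p| = a := abs_bar haa
      have hne : a ≠ b := by rintro rfl; exact lt_irrefl _ hlt
      have hmem : a ∈ S.above m u (S.bar b p) t := by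
        refine mem_above.2 ⟨notMem_of_mem_loose haL hu, by rwa [hba'], S.bar a p, hlt, ?_, haa', e3⟩
        have := bar_le (S := S) (t := p) haa
        have := le_of_mem_loose haL
        omega
      have hss : S.above m u (S.bar a p) t ⊂ S.above m u (S.bar b p) t := by
        refine (ssubset_iff_of_subset ?_).2 ⟨a, hmem, fun h => (mem_above.1 h).2.1 haa'.symm⟩
        intro c hc
        obtain ⟨f1, f2, x, f3, f4, f5, f6⟩ := mem_above.1 hc
        refine mem_above.2 ⟨f1, ?_, x, by omega, f4, f5, f6⟩
        rw [hba']
        rintro rfl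
        have := le_bar hba f6 f5
        omega
      have hlt' := card_lt_card hss
      rcases e5 with e5 | e5
      · rcases e6 with e6 | e6
        · exact hne (e5.symm.trans e6)
        · rw [e5] at e6; exact e6.1 hmem
      · omega
    rw [← ht] at k3 k8
    rw [← hz] at k8
    have n1 := key a b (τ a) (z a) ha hb h3.1 k3.1 h3.2.1 k3.2.2 h8 k8
    have n2 := key b a (τ a) (z a) hb ha k3.1 h3.1 k3.2.1 h3.2.2 k8 h8
    have haa' : |S.bar a p| = a := abs_bar (mem_loose.1 (mem_inter.1 ha).1).1
    have hbb' : |S.bar b p| = b := abs_bar (mem_loose.1 (mem_inter.1 hb).1).1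
    rw [← haa', ← hbb', le_antisymm (not_lt.1 n1) (not_lt.1 n2)]

/-- There are few loose edges. -/
lemma card_loose_le (hmn : m ≤ n) (hlong : ∀ t, m + 1 ≤ (S.line t).card) {u : ℤ}
    (hu : u ∈ S.top m) :
    (S.loose m u).card + (S.inner m u).card + (S.nested m u).card + 1 +
      (m - (S.dn u (S.cl u)).card) ≤
      m + ((S.events m).filter fun e => S.Charged m u e.1 (S.time e)).card := by
  have hua := top_subset hmn hu
  have hu' := mem_top.1 hu
  set p := S.cl u with hp
  -- For a met arc, `key` gives its highest present bar at height at most n - m. `L` collects the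
  -- arcs with such a bar, apart from `u` and `inner u`, and `A` will be the first |nested u| + 1 of
  -- them from above.
  set key : ℤ → ℤ := fun c => if c ≤ (n : ℤ) - m then S.bar c p else -c with hkey
  set L := S.arcs.filter fun c => c ∉ insert u (S.inner m u) ∧
    ∃ y, y ≤ (n : ℤ) - m ∧ |y| = c ∧ S.Pr y p with hL
  have hkabs : ∀ c ∈ S.arcs, |key c| = c := by
    intro c hc
    simp only [hkey]
    split_ifs
    · exact abs_bar hc
    · rw [abs_neg, abs_of_mem hc]
  have hkle : ∀ c ∈ S.arcs, key c ≤ (n : ℤ) - m := by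
    intro c hc
    simp only [hkey]
    have := mem_arcs.1 hc
    split_ifs
    · have := bar_le (S := S) (t := p) hc; omega
    · omega
  have hlek : ∀ c ∈ S.arcs, ∀ y, y ≤ (n : ℤ) - m → |y| = c → S.Pr y p → y ≤ key c := by
    intro c hc y h1 h2 h3
    simp only [hkey]
    split_ifs
    · exact le_bar hc h3 h2
    · rcases abs_choice y with h | h <;> omega
  have hkpr : ∀ c ∈ L, S.Pr (key c) p := by
    intro c hc
    obtain ⟨h1, -, y, h2, h3, h4⟩ := mem_filter.1 hc
    simp only [hkey]
    split_ifs
    · exact pr_bar h4 h3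
    · rcases abs_choice y with h | h
      · omega
      · rwa [show -c = y by omega]
  have hLI : ∀ c ∈ L, c ∉ S.inner m u := fun c hc h =>
    (mem_filter.1 hc).2.1 (mem_insert_of_mem h)
  have hLu : ∀ c ∈ L, c ≠ u := by
    rintro c hc rfl
    exact (mem_filter.1 hc).2.1 (mem_insert_self _ _)
  have hLa : ∀ c ∈ L, c ∈ S.arcs := fun c hc => (mem_filter.1 hc).1
  -- a bar below `u` belongs to `inner` or to `L`
  have hbelow : ∀ z, z < u → S.Pr z p → |z| ≠ u → |z| ∈ S.inner m u ∨ |z| ∈ L := by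
    intro z h1 h2 h3
    have hzn := S.abs_le h2
    by_cases hI : |z| ∈ S.inner m u
    · exact Or.inl hI
    by_cases hz : z ≤ (n : ℤ) - m
    · exact Or.inr (mem_filter.2 ⟨abs_mem_arcs h2, by simp [hI, h3], z, hz, rfl, h2⟩)
    · left
      have hz0 : |z| = z := abs_of_pos (by omega)
      rw [hz0, mem_inner, mem_top]
      exact ⟨⟨by omega, by omega⟩, h1, h2⟩
  set ν := (S.nested m u).card with hν
  set A := L.filter fun a => (L.filter fun b => key a < key b).card < ν + 1 with hAdef
  have hcn := card_inner_add_nested (m := m) hua hu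
  -- `L` is large
  have hdn : (S.dn u p).card ≤ (S.inner m u).card + L.card := by
    refine (card_le_card ?_).trans (card_union_le _ _)
    intro c hc
    obtain ⟨h1, y, h2, rfl, h4⟩ := mem_dn.1 hc
    rw [abs_of_mem hua] at h1
    exact mem_union.2 (hbelow y h2 h4 h1)
  have hupn : ((S.up u p).card : ℤ) ≤ n - u := by
    have : S.up u p ⊆ Ioc u n := by
      intro c hc
      obtain ⟨h1, y, h2, rfl, h4⟩ := mem_up.1 hc
      have := S.abs_le h4
      have := le_abs_self y
      rw [mem_Ioc]; omega
    have := card_le_card this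
    rw [Int.card_Ioc] at this
    omega
  have hud := card_le_card_up_union_dn hua (hlong p)
  have hud' := card_union_le (S.up u p) (S.dn u p)
  -- At least m arcs besides `u` are met, at most n - u of them above `u`, and those below lie in
  -- `inner` or `L`. Since |inner| + |nested| ≤ u - (n - m) - 1, `L` has at least ν + 1 elements.
  have hAcard : ν + 1 ≤ A.card := le_card_of_key (by omega)
  -- `u` sees all of these arcs
  have hAsee : A ⊆ S.seenDn m u p := by
    intro a ha
    obtain ⟨h1, h2⟩ := mem_filter.1 ha
    have h3 := hLa a h1
    have h4 := hkle a h3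
    refine mem_seenDn.2 ⟨key a, hkabs a h3, S.pr_cl_of_mem hua, hkpr a h1, by omega, ?_, ?_⟩
    · rw [abs_of_mem hua, hkabs a h3]; exact (hLu a h1).symm
    · have hsub : S.blk u (key a) p ⊆ S.inner m u ∪ L.filter fun b => key a < key b := by
        intro c hc
        obtain ⟨f1, f2, z, f3, f4, rfl, f6⟩ := mem_blk.1 hc
        rw [abs_of_mem hua] at f1
        by_cases hI : |z| ∈ S.inner m u
        · exact mem_union_left _ hI
        have hzL := (hbelow z f4 f6 f1).resolve_left hI
        refine mem_union_right _ (mem_filter.2 ⟨hzL, ?_⟩)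
        by_cases hz : z ≤ (n : ℤ) - m
        · have := hlek _ (hLa _ hzL) z hz rfl f6
          omega
        · exfalso
          have hzn := S.abs_le f6
          have hz0 : |z| = z := abs_of_pos (by omega)
          exact hI (by rw [hz0, mem_inner, mem_top]; exact ⟨⟨by omega, by omega⟩, f4, f6⟩)
      have := (card_le_card hsub).trans (card_union_le _ _)
      omega
  have hIsee : S.inner m u ⊆ S.seenDn m u p := by
    intro v hv
    obtain ⟨h1, h2, h3⟩ := mem_inner.1 hv
    have hva := top_subset hmn h1
    have hv' := mem_top.1 h1
    refine mem_seenDn.2 ⟨v, abs_of_mem hva, S.pr_cl_of_mem hua, h3, h2, ?_, ?_⟩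
    · rw [abs_of_mem hua, abs_of_mem hva]; omega
    · have hsub : S.blk u v p ⊆ Ioo v u := by
        intro c hc
        obtain ⟨f1, f2, z, f3, f4, rfl, f6⟩ := mem_blk.1 hc
        rw [abs_of_pos (by have := mem_arcs.1 hva; omega), mem_Ioo]
        exact ⟨f3, f4⟩
      have := card_le_card hsub
      rw [Int.card_Ioo] at this
      omega
  have hKsee := loose_subset_seenDn hu
  have hdisj1 : Disjoint (S.inner m u) A := by
    rw [Finset.disjoint_left]
    intro c h1 h2
    exact hLI c (mem_filter.1 h2).1 h1
  have hdisj2 : Disjoint (S.inner m u ∪ A) (S.loose m u \ A) := by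
    rw [Finset.disjoint_left]
    intro c h1 h2
    rw [mem_sdiff] at h2
    rcases mem_union.1 h1 with h | h
    · exact (mem_loose.1 h2.1).2.1 (mem_inner.1 h).1
    · exact h2.2 h
  -- Three disjoint sets of arcs seen below `u`, hence at most min(m, |dn|) arcs in all. The loose
  -- neighbours inside `A` are charged to events instead.
  have hZ : (S.inner m u ∪ A ∪ (S.loose m u \ A)).card ≤ (S.seenDn m u p).card :=
    card_le_card (union_subset (union_subset hIsee hAsee) (sdiff_subset.trans hKsee))
  rw [card_union_of_disjoint hdisj2, card_union_of_disjoint hdisj1] at hZ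
  have hZ1 := S.card_seenDn_le (m := m) (z := u) (t := p)
  have hZ2 := card_le_card (S.seenDn_subset (m := m) (z := u) (t := p))
  have hK := card_sdiff_add_card_inter (S.loose m u) A
  have hch := card_loose_inter_le hmn hu (A := A) (by
    intro a ha haK
    obtain ⟨h1, h2⟩ := mem_filter.1 ha
    have hka : key a = S.bar a p := by simp [hkey, le_of_mem_loose haK]
    rw [← hka]
    refine ⟨hkpr a h1, (card_le_card ?_).trans (Nat.lt_succ_iff.1 h2)⟩
    intro c hc
    obtain ⟨f1, f2, z, f3, f4, rfl, f6⟩ := mem_above.1 hc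
    exact mem_filter.2 ⟨mem_filter.2 ⟨abs_mem_arcs f6, f1, z, f4, rfl, f6⟩,
      lt_of_lt_of_le f3 (hlek _ (abs_mem_arcs f6) z f4 rfl f6)⟩)
  omega

end Sweep

/-! ### Summation for sweeps that always meet more than m arcs -/

namespace Sweep

variable {n : ℕ} {S : Sweep n} {m : ℕ}

/-- Up to full turns, an event of `-w` becomes the same event of `w` after a half turn, which also
turns above into below. -/
lemma up_time_neg {w : ℤ} (hw : w ∈ S.arcs) (b : Bool) :
    S.up (-w) (S.time (-w, b)) = S.dn w (S.time (w, b)) := by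
  have h0 := ne_zero_of_mem hw
  have hn := abs_le_of_mem hw
  have h0' : -w ≠ 0 := neg_ne_zero.2 h0
  have hn' : |-w| ≤ n := by rwa [abs_neg]
  rw [up_neg]
  cases b
  · have h1 := S.pr_cl h0' hn'
    have h2 := S.not_pr_cl h0' hn'
    rw [S.flip] at h1 h2
    obtain ⟨i, hi⟩ := S.cl_unique h1 (by rwa [add_right_comm])
    change S.dn w (S.cl (-w) + S.T) = S.dn w (S.cl w)
    rw [hi, dn_period]
  · have h1 := S.not_pr_op h0' hn'
    have h2 := S.pr_op h0' hn'
    rw [S.flip] at h1 h2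
    obtain ⟨i, hi⟩ := S.op_unique h1 (by rwa [add_right_comm])
    change S.dn w (S.op (-w) + S.T) = S.dn w (S.op w)
    rw [hi, dn_period]

/-- The total number of charged events. -/
lemma sum_charged_le (hmn : m ≤ n) :
    ∑ u ∈ S.top m, ((S.events m).filter fun e => S.Charged m u e.1 (S.time e)).card ≤
      ∑ w ∈ S.arcs, ((m - (S.dn w (S.op w)).card) + (m - (S.dn w (S.cl w)).card)) +
      ∑ w ∈ S.arcs \ S.top m, ((m - (S.up w (S.op w)).card) + (m - (S.up w (S.cl w)).card)) := by
  have hbars : ∀ z ∈ S.arcs.image (fun w => -w) ∪ (S.arcs \ S.top m), |z| ≤ n := by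
    intro z hz
    rcases mem_union.1 hz with h | h
    · obtain ⟨w, hw, rfl⟩ := mem_image.1 h
      rw [abs_neg]; exact abs_le_of_mem hw
    · exact abs_le_of_mem (mem_sdiff.1 h).1
  calc ∑ u ∈ S.top m, ((S.events m).filter fun e => S.Charged m u e.1 (S.time e)).card
      = ∑ e ∈ S.events m, ((S.top m).filter fun u => S.Charged m u e.1 (S.time e)).card := by
        simp only [card_filter]
        exact sum_comm
    _ ≤ ∑ e ∈ S.events m, (m - (S.up e.1 (S.time e)).card) :=
        sum_le_sum fun e he => card_charged_le hmn (hbars e.1 (mem_product.1 he).1)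
    _ = ∑ z ∈ S.arcs.image (fun w => -w) ∪ (S.arcs \ S.top m),
          ((m - (S.up z (S.op z)).card) + (m - (S.up z (S.cl z)).card)) := by
        rw [events, sum_product]
        exact sum_congr rfl fun z _ => by simp [time]
    _ = _ := by
        rw [sum_union, sum_image (fun a _ b _ h => neg_injective h)]
        · congr 1
          refine sum_congr rfl fun w hw => ?_
          have h1 := up_time_neg hw true
          have h2 := up_time_neg hw false
          simp only [time, if_true] at h1 h2
          rw [h1]
          simp only [Bool.false_eq_true, if_false] at h2
          rw [h2]
        · rw [Finset.disjoint_left]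
          intro z h1 h2
          obtain ⟨w, hw, rfl⟩ := mem_image.1 h1
          have := mem_arcs.1 hw
          have := mem_arcs.1 (mem_sdiff.1 h2).1
          omega

/-- The outermost arcs above the arcs of `top` are balanced by those below. -/
lemma sum_up_le (hmn : m ≤ n) :
    ∑ u ∈ S.top m, (S.up u (S.op u)).card ≤
      ∑ u ∈ S.top m, ((S.inner m u).card + (S.nested m u).card) := by
  calc ∑ u ∈ S.top m, (S.up u (S.op u)).card
      ≤ ∑ u ∈ S.top m, ((S.top m).filter fun v => u < v ∧ S.Pr v (S.op u)).card := by
        refine sum_le_sum fun u hu => card_le_card fun c hc => ?_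
        obtain ⟨h1, y, h2, rfl, h3⟩ := mem_up.1 hc
        have hu' := mem_top.1 hu
        have hua := mem_arcs.1 (top_subset hmn hu)
        have hy : |y| = y := abs_of_pos (by omega)
        have := S.abs_le h3
        rw [hy] at this ⊢
        exact mem_filter.2 ⟨mem_top.2 ⟨by omega, this⟩, h2, h3⟩
    _ = ∑ v ∈ S.top m, ((S.top m).filter fun u => u < v ∧ S.Pr v (S.op u)).card := by
        simp only [card_filter]
        exact sum_comm
    _ ≤ _ := by
        refine sum_le_sum fun u hu => ?_
        refine (card_le_card fun v hv => ?_).trans (card_union_le _ _)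
        obtain ⟨h1, h2, h3⟩ := mem_filter.1 hv
        exact mem_union.2 (mem_inner_or_nested hmn hu h1 h2 h3)

/-- Closings of outermost arcs are deliberately left out. An edge in none of the remaining slots has
an end in `top`, by `edges_classify`; it either joins two outermost arcs or is loose by definition.
-/
lemma edges_subset (S : Sweep n) (m : ℕ) : S.edges m ⊆
    (S.top m).offDiag.image Sym2.mk.uncurry ∪
      (S.top m).biUnion (fun u => (S.loose m u).image fun a => s(u, a)) ∪
      (S.arcs \ S.top m).biUnion (fun w => S.closeSlots m w) ∪
      S.arcs.biUnion (fun w => S.openSlots m w) := by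
  intro s hs
  by_cases h1 : ∃ w ∈ S.arcs, s ∈ S.openSlots m w
  · exact mem_union_right _ (mem_biUnion.2 h1)
  refine mem_union_left _ ?_
  by_cases h2 : ∃ w ∈ S.arcs, w ∉ S.top m ∧ s ∈ S.closeSlots m w
  · obtain ⟨w, e1, e2, e3⟩ := h2
    exact mem_union_right _ (mem_biUnion.2 ⟨w, mem_sdiff.2 ⟨e1, e2⟩, e3⟩)
  refine mem_union_left _ ?_
  push Not at h1 h2
  have key : ∀ u a : ℤ, u ∈ S.top m → a ∈ S.arcs → a ∉ S.top m → s = s(u, a) →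
      s ∈ (S.top m).biUnion (fun u => (S.loose m u).image fun a => s(u, a)) := by
    rintro u a hu ha hat rfl
    exact mem_biUnion.2 ⟨u, hu, mem_image_of_mem _ (mem_loose.2 ⟨ha, hat, hs, h2, h1⟩)⟩
  obtain ⟨x, y, t, hv, hxy⟩ := mem_edges.1 hs
  have hxa := abs_mem_arcs hv.1
  have hya := abs_mem_arcs hv.2.1
  by_cases hx : |x| ∈ S.top m <;> by_cases hy : |y| ∈ S.top m
  · refine mem_union_left _ (mem_image.2 ⟨(|x|, |y|), mem_offDiag.2 ⟨hx, hy, hv.2.2.2.1⟩, hxy.symm⟩)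
  · exact mem_union_right _ (key _ _ hx hya hy hxy)
  · exact mem_union_right _ (key _ _ hy hxa hx (hxy.trans Sym2.eq_swap))
  · exfalso
    rcases edges_classify hs with ⟨w, hw, h⟩ | ⟨w, hw, h⟩
    · rw [hxy, Sym2.mem_iff] at hw
      rcases hw with rfl | rfl
      · exact h2 _ hxa hx h
      · exact h2 _ hya hy h
    · exact h1 w hw h

/-- The bound for sweeps in which the line always meets more than `m` arcs. -/
theorem card_edges_le (hmn : m ≤ n) (hlong : ∀ t, m + 1 ≤ (S.line t).card) :
    2 * (S.edges m).card + 3 * m * (m + 1) ≤ 6 * m * n := by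
  set T := S.top m with hT
  set R := S.arcs \ T with hR
  have hTa : T ⊆ S.arcs := top_subset hmn
  have hcT : T.card = m := card_top
  have hca : S.arcs.card = n := by simp [arcs]
  have hcR : R.card + m = n := by
    rw [← hcT, ← hca]; exact card_sdiff_add_card_eq_card hTa
  have hE : (S.edges m).card ≤ m.choose 2 + ∑ u ∈ T, (S.loose m u).card +
      ∑ w ∈ R, (S.closeSlots m w).card + ∑ w ∈ S.arcs, (S.openSlots m w).card := by
    refine (card_le_card (edges_subset S m)).trans ?_
    refine (card_union_le _ _).trans (add_le_add ?_ card_biUnion_le)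
    refine (card_union_le _ _).trans (add_le_add ?_ card_biUnion_le)
    refine (card_union_le _ _).trans (add_le_add ?_ ?_)
    · rw [Sym2.card_image_offDiag, ← hT, hcT]
    · exact card_biUnion_le.trans (sum_le_sum fun u _ => card_image_le)
  -- The deficits in `hloose`, `hclose` and `hopen` cancel the charges in `hch`, except those above
  -- arcs of `top` when they appear. With `inner` and `nested` these give m² by `hup`, and what
  -- remains is m(m-1)/2 + 3mn - 2m² - m.
  have hloose := sum_le_sum fun u (hu : u ∈ T) => card_loose_le hmn hlong hu
  have hclose := sum_le_sum fun w (_ : w ∈ R) => S.card_closeSlots_le (m := m) (w := w)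
  have hopen := sum_le_sum fun w (hw : w ∈ S.arcs) =>
    card_openSlots_le hw (card_le_card_up_union_dn hw (hlong (S.op w)))
  have hch := sum_charged_le (S := S) hmn
  have hup := sum_up_le (S := S) hmn
  have hup' : ∑ u ∈ T, m ≤ ∑ u ∈ T, ((m - (S.up u (S.op u)).card) + (S.up u (S.op u)).card) :=
    sum_le_sum fun u _ => by omega
  have hsplit : ∀ f : ℤ → ℕ, ∑ w ∈ S.arcs, f w = ∑ w ∈ R, f w + ∑ w ∈ T, f w :=
    fun f => (sum_sdiff hTa).symm
  simp only [sum_add_distrib, sum_const, smul_eq_mul, hcT, hsplit]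
    at hloose hclose hopen hch hup hup' hE
  have hch2 : 2 * m.choose 2 + m = m * m := by
    rw [Nat.choose_two_right]
    have := Nat.div_mul_cancel (Nat.even_mul_pred_self m).two_dvd
    rcases m with _ | m
    · simp
    · simp only [Nat.add_sub_cancel] at this ⊢
      nlinarith
  obtain ⟨r, hr⟩ : ∃ r, r = R.card := ⟨_, rfl⟩
  rw [← hr] at hclose hcR
  subst hcR
  nlinarith

end Sweep

/-! ### Discrete arcs and their sweeps -/

/-- Arcs given by the instants at which they appear and disappear on the ray of the sweep line;
`2 * T` instants are a full turn. -/
structure BarSystem (n : ℕ) (T : ℤ) where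
  start : ℤ → ℤ
  finish : ℤ → ℤ
  T_pos : 0 < T
  start_lt : ∀ {w : ℤ}, 1 ≤ w → w ≤ n → start w < finish w
  finish_lt : ∀ {w : ℤ}, 1 ≤ w → w ≤ n → finish w < start w + 2 * T
  -- Modulo `T` rather than `2 * T`: events on opposite rays must not coincide either.
  start_inj : ∀ {w w' : ℤ}, 1 ≤ w → w ≤ n → 1 ≤ w' → w' ≤ n → T ∣ start w - start w' → w = w'
  finish_inj : ∀ {w w' : ℤ}, 1 ≤ w → w ≤ n → 1 ≤ w' → w' ≤ n → T ∣ finish w - finish w' → w = w'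
  start_ne_finish : ∀ {w w' : ℤ}, 1 ≤ w → w ≤ n → 1 ≤ w' → w' ≤ n → ¬ T ∣ start w - finish w'

namespace BarSystem

variable {n : ℕ} {T : ℤ} (B : BarSystem n T)

/-- The arc `w` is met by the positive ray at the instant `t`. -/
def Met (w t : ℤ) : Prop := ∃ i : ℤ, B.start w + 2 * T * i ≤ t ∧ t < B.finish w + 2 * T * i

/-- The bar `z` is met by the line at the instant `t`. -/
def Present (z t : ℤ) : Prop :=
  (1 ≤ z ∧ z ≤ n ∧ B.Met z t) ∨ (1 ≤ -z ∧ -z ≤ n ∧ B.Met (-z) (t + T))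

variable {B}

lemma met_add {w t : ℤ} : B.Met w (t + 2 * T) ↔ B.Met w t := by
  constructor
  · rintro ⟨i, h1, h2⟩
    exact ⟨i - 1, by linarith, by linarith⟩
  · rintro ⟨i, h1, h2⟩
    exact ⟨i + 1, by linarith, by linarith⟩

lemma met_finish_unique {w t : ℤ} (h : B.Met w t) (h' : ¬ B.Met w (t + 1)) :
    ∃ i : ℤ, t + 1 = B.finish w + 2 * T * i := by
  obtain ⟨i, h1, h2⟩ := h
  refine ⟨i, ?_⟩
  by_contra hne
  exact h' ⟨i, by omega, by omega⟩

lemma met_start_unique {w t : ℤ} (h : ¬ B.Met w t) (h' : B.Met w (t + 1)) :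
    ∃ i : ℤ, t + 1 = B.start w + 2 * T * i := by
  obtain ⟨i, h1, h2⟩ := h'
  refine ⟨i, ?_⟩
  by_contra hne
  exact h ⟨i, by omega, by omega⟩

lemma met_start {w : ℤ} (h1 : 1 ≤ w) (hn : w ≤ n) : B.Met w (B.start w) :=
  ⟨0, by simp, by simpa using B.start_lt h1 hn⟩

lemma not_met_start {w : ℤ} (h1 : 1 ≤ w) (hn : w ≤ n) : ¬ B.Met w (B.start w - 1) := by
  rintro ⟨i, h2, h3⟩
  have hT := B.T_pos
  have := B.finish_lt h1 hn
  have hi : i < 0 := by by_contra! h; nlinarith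
  nlinarith

lemma met_finish {w : ℤ} (h1 : 1 ≤ w) (hn : w ≤ n) : B.Met w (B.finish w - 1) :=
  ⟨0, by have := B.start_lt h1 hn; linarith, by linarith⟩

lemma not_met_finish {w : ℤ} (h1 : 1 ≤ w) (hn : w ≤ n) : ¬ B.Met w (B.finish w) := by
  rintro ⟨i, h2, h3⟩
  have hT := B.T_pos
  have := B.finish_lt h1 hn
  have hi : 0 < i := by by_contra! h; nlinarith
  nlinarith

lemma present_pos {z t : ℤ} (h1 : 1 ≤ z) (hn : z ≤ n) : B.Present z t ↔ B.Met z t :=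
  ⟨fun h => h.elim (fun h => h.2.2) (fun h => by omega), fun h => Or.inl ⟨h1, hn, h⟩⟩

lemma present_neg {z t : ℤ} (h1 : 1 ≤ -z) (hn : -z ≤ n) : B.Present z t ↔ B.Met (-z) (t + T) :=
  ⟨fun h => h.elim (fun h => by omega) (fun h => h.2.2), fun h => Or.inr ⟨h1, hn, h⟩⟩

lemma present_flip {z t : ℤ} : B.Present (-z) t ↔ B.Present z (t + T) := by
  rw [Present, Present, neg_neg, add_assoc, ← two_mul, met_add]
  exact or_comm

/-- The range of a bar. -/
lemma Present.range {z t : ℤ} (h : B.Present z t) : (1 ≤ z ∧ z ≤ n) ∨ (1 ≤ -z ∧ -z ≤ n) :=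
  h.imp (fun h => ⟨h.1, h.2.1⟩) fun h => ⟨h.1, h.2.1⟩

lemma range_of {z : ℤ} (h0 : z ≠ 0) (hn : |z| ≤ n) :
    (1 ≤ z ∧ z ≤ n) ∨ (1 ≤ -z ∧ -z ≤ n) := by
  rw [abs_le] at hn; omega

lemma present_finish_unique {z t : ℤ} (h : B.Present z t) (h' : ¬ B.Present z (t + 1)) :
    (1 ≤ |z| ∧ |z| ≤ n) ∧ ∃ i : ℤ, t + 1 + (if 0 < z then 0 else T) = B.finish |z| + 2 * T * i := by
  rcases h.range with ⟨h1, h2⟩ | ⟨h1, h2⟩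
  · rw [present_pos h1 h2] at h h'
    rw [if_pos (by omega), abs_of_pos (by omega), add_zero]
    exact ⟨⟨h1, h2⟩, met_finish_unique h h'⟩
  · rw [present_neg h1 h2] at h h'
    rw [if_neg (by omega), abs_of_neg (by omega), add_right_comm]
    rw [add_right_comm] at h'
    exact ⟨⟨h1, h2⟩, met_finish_unique h h'⟩

lemma present_start_unique {z t : ℤ} (h : ¬ B.Present z t) (h' : B.Present z (t + 1)) :
    (1 ≤ |z| ∧ |z| ≤ n) ∧ ∃ i : ℤ, t + 1 + (if 0 < z then 0 else T) = B.start |z| + 2 * T * i := by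
  rcases h'.range with ⟨h1, h2⟩ | ⟨h1, h2⟩
  · rw [present_pos h1 h2] at h h'
    rw [if_pos (by omega), abs_of_pos (by omega), add_zero]
    exact ⟨⟨h1, h2⟩, met_start_unique h h'⟩
  · rw [present_neg h1 h2] at h h'
    rw [if_neg (by omega), abs_of_neg (by omega), add_right_comm]
    rw [add_right_comm] at h'
    exact ⟨⟨h1, h2⟩, met_start_unique h h'⟩

lemma eq_of_times {z z' t a i j : ℤ} (hz : |z| = |z'|) (hT : 0 < T)
    (h : t + 1 + (if 0 < z then 0 else T) = a + 2 * T * i)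
    (h' : t + 1 + (if 0 < z' then 0 else T) = a + 2 * T * j) : z = z' := by
  by_contra hne
  have hz' : z' = -z := by
    rcases abs_eq_abs.1 hz with h | h
    · exact absurd h hne
    · omega
  have key : ∀ k : ℤ, T ≠ 2 * T * k := by
    intro k hk
    have : 0 < k := by by_contra! h; nlinarith
    nlinarith
  by_cases hp : 0 < z
  · rw [if_pos hp] at h
    rw [if_neg (by omega)] at h'
    exact key (j - i) (by linarith)
  · rw [if_neg hp] at h
    rw [if_pos (by omega)] at h'
    exact key (i - j) (by linarith)

lemma dvd_sub_of_times {z z' t a b i j : ℤ}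
    (h : t + 1 + (if 0 < z then 0 else T) = a + 2 * T * i)
    (h' : t + 1 + (if 0 < z' then 0 else T) = b + 2 * T * j) : T ∣ a - b := by
  obtain ⟨c, hc⟩ : ∃ c : ℤ, (if 0 < z then 0 else T) = T * c := by
    split_ifs; exacts [⟨0, by simp⟩, ⟨1, by simp⟩]
  obtain ⟨c', hc'⟩ : ∃ c : ℤ, (if 0 < z' then 0 else T) = T * c := by
    split_ifs; exacts [⟨0, by simp⟩, ⟨1, by simp⟩]
  rw [hc] at h
  rw [hc'] at h'
  exact ⟨c - 2 * i - c' + 2 * j, by linear_combination h' - h⟩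

variable (B)

/-- The sweep of a bar system. -/
def toSweep : Sweep n where
  T := T
  Pr := B.Present
  op z := if 0 < z then B.start z - 1 else B.start (-z) - 1 - T
  cl z := if 0 < z then B.finish z - 1 else B.finish (-z) - 1 - T
  T_pos := B.T_pos
  ne_zero h := by rcases h.range with h | h <;> omega
  abs_le h := by rw [_root_.abs_le]; rcases h.range with h | h <;> constructor <;> omega
  flip := present_flip
  single {z z' t} h h' := by
    have hT := B.T_pos
    by_cases p : B.Present z t <;> by_cases p' : B.Present z' t
    · obtain ⟨⟨h1, h2⟩, i, hi⟩ := present_finish_unique p (h.1 p)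
      obtain ⟨⟨h1', h2'⟩, j, hj⟩ := present_finish_unique p' (h'.1 p')
      have he := B.finish_inj h1 h2 h1' h2' (dvd_sub_of_times hi hj)
      rw [← he] at hj
      exact eq_of_times he hT hi hj
    · rw [iff_comm, not_iff_comm] at h'
      obtain ⟨⟨h1, h2⟩, i, hi⟩ := present_finish_unique p (h.1 p)
      obtain ⟨⟨h1', h2'⟩, j, hj⟩ := present_start_unique p' (h'.1 p')
      exact absurd (dvd_sub_of_times hj hi) (B.start_ne_finish h1' h2' h1 h2)
    · rw [iff_comm, not_iff_comm] at h
      obtain ⟨⟨h1, h2⟩, i, hi⟩ := present_start_unique p (h.1 p)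
      obtain ⟨⟨h1', h2'⟩, j, hj⟩ := present_finish_unique p' (h'.1 p')
      exact absurd (dvd_sub_of_times hi hj) (B.start_ne_finish h1 h2 h1' h2')
    · rw [iff_comm, not_iff_comm] at h h'
      obtain ⟨⟨h1, h2⟩, i, hi⟩ := present_start_unique p (h.1 p)
      obtain ⟨⟨h1', h2'⟩, j, hj⟩ := present_start_unique p' (h'.1 p')
      have he := B.start_inj h1 h2 h1' h2' (dvd_sub_of_times hi hj)
      rw [← he] at hj
      exact eq_of_times he hT hi hj
  not_pr_op {z} h0 hn := by
    rcases range_of h0 hn with ⟨h1, h2⟩ | ⟨h1, h2⟩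
    · rw [if_pos (by omega), present_pos h1 h2]; exact not_met_start h1 h2
    · rw [if_neg (by omega), present_neg h1 h2, sub_add_cancel]; exact not_met_start h1 h2
  pr_op {z} h0 hn := by
    rcases range_of h0 hn with ⟨h1, h2⟩ | ⟨h1, h2⟩
    · rw [if_pos (by omega), present_pos h1 h2, sub_add_cancel]; exact met_start h1 h2
    · rw [if_neg (by omega), present_neg h1 h2]; convert met_start h1 h2 using 1; ring
  pr_cl {z} h0 hn := by
    rcases range_of h0 hn with ⟨h1, h2⟩ | ⟨h1, h2⟩
    · rw [if_pos (by omega), present_pos h1 h2]; exact met_finish h1 h2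
    · rw [if_neg (by omega), present_neg h1 h2, sub_add_cancel]; exact met_finish h1 h2
  not_pr_cl {z} h0 hn := by
    rcases range_of h0 hn with ⟨h1, h2⟩ | ⟨h1, h2⟩
    · rw [if_pos (by omega), present_pos h1 h2, sub_add_cancel]; exact not_met_finish h1 h2
    · rw [if_neg (by omega), present_neg h1 h2,
        show B.finish (-z) - 1 - T + 1 + T = B.finish (-z) by ring]
      exact not_met_finish h1 h2
  op_unique {z t} h h' := by
    obtain ⟨-, i, hi⟩ := present_start_unique h h'
    refine ⟨i, ?_⟩
    rcases h'.range with ⟨h1, h2⟩ | ⟨h1, h2⟩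
    · rw [if_pos (by omega), abs_of_pos (by omega)] at hi
      rw [if_pos (by omega)]; linarith
    · rw [if_neg (by omega), abs_of_neg (by omega)] at hi
      rw [if_neg (by omega)]; linarith
  cl_unique {z t} h h' := by
    obtain ⟨-, i, hi⟩ := present_finish_unique h h'
    refine ⟨i, ?_⟩
    rcases h.range with ⟨h1, h2⟩ | ⟨h1, h2⟩
    · rw [if_pos (by omega), abs_of_pos (by omega)] at hi
      rw [if_pos (by omega)]; linarith
    · rw [if_neg (by omega), abs_of_neg (by omega)] at hi
      rw [if_neg (by omega)]; linarith

end BarSystem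

/-! ### Prolonging an arc when the line meets few arcs -/

namespace BarSystem

variable {n : ℕ} {T : ℤ}

/-- Move the instants congruent to `t` modulo `T` behind the `r` instants that follow them. -/
def delay (T t r j : ℤ) : ℤ :=
  if (j - t) % T = 0 then j + r else if (j - t) % T ≤ r then j - 1 else j

lemma emod_eq {T t j a d : ℤ} (h : j = t + T * a + d) (h0 : 0 ≤ d) (hd : d < T) :
    (j - t) % T = d := by
  rw [h, show t + T * a + d - t = d + T * a by ring, Int.add_mul_emod_self_left,
    Int.emod_eq_of_lt h0 hd]

lemma exists_emod {T : ℤ} (hT : 0 < T) (t j : ℤ) :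
    ∃ a d, j = t + T * a + d ∧ 0 ≤ d ∧ d < T ∧ (j - t) % T = d :=
  ⟨(j - t) / T, (j - t) % T, by have := Int.emod_add_mul_ediv (j - t) T; linarith,
    Int.emod_nonneg _ hT.ne', Int.emod_lt_of_pos _ hT, rfl⟩

lemma dvd_sub_iff {T t j j' : ℤ} : T ∣ j - j' ↔ (j - t) % T = (j' - t) % T := by
  rw [Int.emod_eq_emod_iff_emod_sub_eq_zero, ← Int.dvd_iff_emod_eq_zero]
  rw [show j - t - (j' - t) = j - j' by ring]

lemma delay_add {T t r j : ℤ} (k : ℤ) : delay T t r (j + T * k) = delay T t r j + T * k := by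
  have : (j + T * k - t) % T = (j - t) % T := by
    rw [show j + T * k - t = j - t + T * k by ring, Int.add_mul_emod_self_left]
  unfold delay
  rw [this]
  split_ifs <;> ring

/-- On residues relative to `t`, `delay` permutes 0, …, r cyclically, so it keeps distinct events
distinct modulo `T`. -/
lemma delay_emod {T t r j : ℤ} (hT : 0 < T) (hr : 1 ≤ r) (hrT : r < T) :
    (delay T t r j - t) % T =
      if (j - t) % T = 0 then r else if (j - t) % T ≤ r then (j - t) % T - 1 else (j - t) % T := by
  obtain ⟨a, d, h1, h2, h3, h4⟩ := exists_emod hT t j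
  unfold delay
  rw [h4]
  split_ifs
  · exact emod_eq (a := a) (by omega) (by omega) hrT
  · exact emod_eq (a := a) (by omega) (by omega) (by omega)
  · exact h4

lemma dvd_of_dvd_delay {T t r j j' : ℤ} (hT : 0 < T) (hr : 1 ≤ r) (hrT : r < T)
    (h : T ∣ delay T t r j - delay T t r j') : T ∣ j - j' := by
  rw [dvd_sub_iff (t := t)] at h ⊢
  rw [delay_emod hT hr hrT, delay_emod hT hr hrT] at h
  have := Int.emod_nonneg (j - t) hT.ne'
  have := Int.emod_nonneg (j' - t) hT.ne'
  split_ifs at h <;> omega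

/-- Instants move only inside the windows [t, t + r] modulo `T`, so their order relative to an
instant outside [t, t + r) is unchanged. Hence presence changes only in those half-open windows. -/
lemma delay_le_iff {T t r j i : ℤ} (hT : 0 < T) (hr : 1 ≤ r)
    (hi : r ≤ (i - t) % T) : delay T t r j ≤ i ↔ j ≤ i := by
  obtain ⟨a, d, h1, h2, h3, h4⟩ := exists_emod hT t j
  obtain ⟨b, e, k1, k2, k3, k4⟩ := exists_emod hT t i
  unfold delay
  rw [h4]
  split_ifs with h h'
  · refine ⟨fun _ => by omega, fun hle => ?_⟩
    have hab : a < b + 1 := by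
      by_contra! hba
      have := mul_le_mul_of_nonneg_left hba hT.le
      rw [mul_add] at this
      omega
    have := mul_le_mul_of_nonneg_left (Int.lt_add_one_iff.1 hab) hT.le
    omega
  · refine ⟨fun hle => ?_, fun _ => by omega⟩
    by_contra! hlt
    have := emod_eq (T := T) (t := t) (j := i) (a := a) (d := d - 1)
      (by omega) (by omega) (by omega)
    omega
  · rfl

variable (B : BarSystem n T)

lemma present_add {z t : ℤ} : B.Present z (t + T) ↔ B.Present (-z) t := present_flip.symm

lemma line_add {t : ℤ} (i : ℤ) : B.toSweep.line (t + T * i) = B.toSweep.line t := by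
  have h1 : ∀ t, B.toSweep.line (t + T) = B.toSweep.line t := by
    intro t
    ext c
    simp only [Sweep.line, mem_filter]
    refine and_congr_right fun _ => ?_
    change B.Present c (t + T) ∨ B.Present (-c) (t + T) ↔ B.Present c t ∨ B.Present (-c) t
    rw [present_add, present_add, neg_neg, or_comm]
  induction i using Int.induction_on with
  | zero => simp
  | succ i ih => rw [← ih, ← h1 (t + T * i)]; congr 1; ring
  | pred i ih => rw [← ih, ← h1 (t + T * (-i - 1))]; congr 1; ring

/-- The total length of the arcs. -/
def len : ℤ := ∑ w ∈ Icc 1 (n : ℤ), (B.finish w - B.start w)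

lemma len_le : B.len ≤ n * (2 * T) := by
  unfold len
  refine (sum_le_card_nsmul _ _ (2 * T) fun w hw => ?_).trans (by simp)
  rw [mem_Icc] at hw
  have := B.finish_lt hw.1 hw.2
  omega

variable {B} {m : ℕ}

/-- Prolonging an arc over instants at which the line meets at most `m` further arcs. -/
lemma exists_longer {y : ℤ} (hy : 1 ≤ y) (hyn : y ≤ n)
    (hline : y ∉ B.toSweep.line (B.finish y))
    (hcard : (B.toSweep.line (B.finish y - 1)).card ≤ m + 1) :
    ∃ B' : BarSystem n T, B.toSweep.edges m ⊆ B'.toSweep.edges m ∧ B.len < B'.len := by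
  have hT := B.T_pos
  set t := B.finish y with ht
  -- the arc `y` is short
  have hshort : t < B.start y + T := by
    by_contra! h
    refine hline (mem_filter.2 ⟨Sweep.mem_arcs.2 ⟨hy, hyn⟩, Or.inr ?_⟩)
    change B.Present (-y) t
    rw [present_flip, present_pos hy hyn]
    exact ⟨1, by omega, by omega⟩
  have hys := B.start_lt hy hyn
  -- the next start
  have hex : ∃ r : ℕ, 1 ≤ r ∧ ∃ w : ℤ, 1 ≤ w ∧ w ≤ n ∧ (B.start w - t) % T = r := by
    have h0 := Int.emod_nonneg (B.start y - t) hT.ne'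
    refine ⟨((B.start y - t) % T).toNat, ?_, y, hy, hyn, by omega⟩
    have : (B.start y - t) % T ≠ 0 := fun h =>
      B.start_ne_finish hy hyn hy hyn (Int.dvd_of_emod_eq_zero h)
    omega
  obtain ⟨hr1, w₀, hw1, hw2, hw3⟩ := Nat.find_spec hex
  have hmin : ∀ w : ℤ, 1 ≤ w → w ≤ n → (Nat.find hex : ℤ) ≤ (B.start w - t) % T := by
    intro w h1 h2
    have h0 := Int.emod_nonneg (B.start w - t) hT.ne'
    have hne : (B.start w - t) % T ≠ 0 := fun h =>
      B.start_ne_finish h1 h2 hy hyn (Int.dvd_of_emod_eq_zero h)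
    have := Nat.find_min' hex (m := ((B.start w - t) % T).toNat)
      ⟨by omega, w, h1, h2, by omega⟩
    omega
  obtain ⟨r, hr⟩ : ∃ r : ℤ, r = (Nat.find hex : ℤ) := ⟨_, rfl⟩
  rw [← hr] at hw3 hmin
  replace hr1 : 1 ≤ r := by omega
  have hrT : r < T := by rw [← hw3]; exact Int.emod_lt_of_pos _ hT
  have hfinish0 : ∀ w : ℤ, 1 ≤ w → w ≤ n → (B.finish w - t) % T = 0 → w = y := fun w h1 h2 h =>
    B.finish_inj h1 h2 hy hyn (Int.dvd_of_emod_eq_zero h)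
  have hfinishr : ∀ w : ℤ, 1 ≤ w → w ≤ n → (B.finish w - t) % T ≠ r := fun w h1 h2 h =>
    B.start_ne_finish hw1 hw2 h1 h2 (dvd_sub_iff.2 (hw3.trans h.symm))
  have hty : (B.finish y - t) % T = 0 := by rw [← ht]; simp
  have hdstart : ∀ w : ℤ, 1 ≤ w → w ≤ n → delay T t r (B.start w) =
      B.start w - if (B.start w - t) % T = r then 1 else 0 := by
    intro w h1 h2
    have := hmin w h1 h2
    unfold delay
    split_ifs <;> omega
  have hdfinish : ∀ w : ℤ, 1 ≤ w → w ≤ n → delay T t r (B.finish w) =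
      B.finish w + (if w = y then r else 0) - if (B.finish w - t) % T ∈ Ioo 0 r then 1 else 0 := by
    intro w h1 h2
    have h3 := hfinish0 w h1 h2
    have h4 := hfinishr w h1 h2
    have h5 := Int.emod_nonneg (B.finish w - t) hT.ne'
    unfold delay
    simp only [mem_Ioo]
    by_cases hwy : w = y
    · subst hwy; simp [hty]
    · rw [if_neg (fun h => hwy (h3 h)), if_neg hwy]
      split_ifs <;> omega
  -- The finish of `y` moves just behind the next start modulo `T`, that of `w₀`; the events it
  -- passes move one instant earlier.
  let B' : BarSystem n T :=
    { start := fun w => delay T t r (B.start w)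
      finish := fun w => delay T t r (B.finish w)
      T_pos := hT
      start_lt := by
        intro w h1 h2
        have h3 := B.start_lt h1 h2
        have h4 := hmin w h1 h2
        rw [hdstart w h1 h2, hdfinish w h1 h2]
        obtain ⟨a, d, e1, e2, e3, e4⟩ := exists_emod hT t (B.finish w)
        -- A start one instant before such a finish would have residue less than `r`, against the
        -- choice of `r`.
        have : (B.finish w - t) % T ∈ Ioo 0 r → B.start w < B.finish w - 1 := by
          intro h
          rw [mem_Ioo, e4] at h
          by_contra! hle
          have := emod_eq (T := T) (t := t) (j := B.start w) (a := a) (d := d - 1) (by omega)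
            (by omega) (by omega)
          omega
        by_cases hm : (B.finish w - t) % T ∈ Ioo 0 r
        · rw [if_pos hm]
          have := this hm
          split_ifs <;> omega
        · rw [if_neg hm]
          split_ifs <;> omega
      finish_lt := by
        intro w h1 h2
        have h3 := B.finish_lt h1 h2
        have h4 := hmin w h1 h2
        rw [hdstart w h1 h2, hdfinish w h1 h2]
        by_cases hwy : w = y
        · subst hwy
          rw [if_pos rfl]
          split_ifs <;> omega
        rw [if_neg hwy]
        obtain ⟨a, d, e1, e2, e3, e4⟩ := exists_emod hT t (B.start w)
        by_cases hd : d = r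
        swap
        · rw [e4, if_neg hd]; split_ifs <;> omega
        -- In the critical case the arc lacks a single instant of a full turn and its start moves
        -- earlier. Its finish then has residue r - 1, nonzero as w ≠ y, and moves as well.
        by_cases hl : B.finish w = B.start w + 2 * T - 1
        swap
        · split_ifs <;> omega
        have h5 := emod_eq (T := T) (t := t) (j := B.finish w) (a := a + 2) (d := d - 1)
          (by rw [hl, e1]; ring) (by omega) (by omega)
        have h6 : (B.finish w - t) % T ≠ 0 := fun h => hwy (hfinish0 w h1 h2 h)
        rw [if_pos (by rw [mem_Ioo]; omega)]
        split_ifs <;> omega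
      start_inj := fun h1 h2 h3 h4 h => B.start_inj h1 h2 h3 h4 (dvd_of_dvd_delay hT hr1 hrT h)
      finish_inj := fun h1 h2 h3 h4 h => B.finish_inj h1 h2 h3 h4 (dvd_of_dvd_delay hT hr1 hrT h)
      start_ne_finish := fun h1 h2 h3 h4 h =>
        B.start_ne_finish h1 h2 h3 h4 (dvd_of_dvd_delay hT hr1 hrT h) }
  have hmet : ∀ w i, r ≤ (i - t) % T → (B'.Met w i ↔ B.Met w i) := by
    intro w i hi
    refine exists_congr fun k => ?_
    change delay T t r (B.start w) + 2 * T * k ≤ i ∧ i < delay T t r (B.finish w) + 2 * T * k ↔ _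
    rw [show 2 * T * k = T * (2 * k) by ring, ← delay_add, ← delay_add, delay_le_iff hT hr1 hi,
      ← not_le, delay_le_iff hT hr1 hi, not_le]
  have hpres : ∀ z i, r ≤ (i - t) % T → (B'.Present z i ↔ B.Present z i) := by
    intro z i hi
    unfold Present
    rw [hmet _ _ hi, hmet _ (i + T)]
    rwa [show i + T - t = i - t + T * 1 by ring, Int.add_mul_emod_self_left]
  have hvis : ∀ x z i, r ≤ (i - t) % T → B.toSweep.Vis m x z i → B'.toSweep.Vis m x z i := by
    rintro x z i hi ⟨h1, h2, h3, h4, h5⟩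
    refine ⟨(hpres x i hi).2 h1, (hpres z i hi).2 h2, h3, h4, lt_of_le_of_lt (card_le_card ?_) h5⟩
    intro c hc
    obtain ⟨f1, f2, b, f3, f4, f5, f6⟩ := Sweep.mem_blk.1 hc
    exact Sweep.mem_blk.2 ⟨f1, f2, b, f3, f4, f5, (hpres b i hi).1 f6⟩
  refine ⟨B', ?_, ?_⟩
  · intro s hs
    obtain ⟨x, z, i, hv, hs⟩ := Sweep.mem_edges.1 hs
    refine Sweep.mem_edges.2 ?_
    obtain ⟨b, e, k1, k2, k3, k4⟩ := exists_emod hT t i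
    rcases le_or_gt r e with he | he
    · exact ⟨x, z, i, hvis x z i (by omega) hv, hs⟩
    -- Nothing appears at residues 0, …, r - 1, so the bars met in the window were all met just
    -- before it. There the line meets at most m + 1 arcs, so any two of them have fewer than m
    -- blockers.
    have hpast : ∀ c, B.Present c i → B.Present c (i - e - 1) := by
      intro c hc
      by_contra hn
      obtain ⟨j, f1, f2, f3, f4⟩ := Sweep.exists_step (P := fun j => ¬ B.Present c j)
        (a := i - e - 1) (b := i) (by omega) hn (not_not.2 hc)
      rw [not_not] at f4
      obtain ⟨⟨g1, g2⟩, l, hl⟩ := present_start_unique (f3 j f1 le_rfl) f4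
      have h5 := hmin _ g1 g2
      obtain ⟨c', hc'⟩ : ∃ k : ℤ, (if 0 < c then 0 else T) = T * k := by
        split_ifs; exacts [⟨0, by simp⟩, ⟨1, by simp⟩]
      rw [hc'] at hl
      have := emod_eq (T := T) (t := t) (j := B.start |c|) (a := b + c' - 2 * l)
        (d := j + 1 - (i - e)) (by linear_combination k1 - hl) (by omega) (by omega)
      omega
    have hc : (B.toSweep.line (i - e - 1)).card ≤ m + 1 := by
      rw [show i - e - 1 = t - 1 + T * b by omega, line_add]
      exact hcard
    refine ⟨x, z, i - e - 1, hvis x z _ ?_ ⟨hpast x hv.1, hpast z hv.2.1, hv.2.2.1, hv.2.2.2.1, ?_⟩,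
      hs⟩
    · rw [emod_eq (T := T) (t := t) (a := b - 1) (d := T - 1) (by rw [mul_sub]; omega) (by omega)
        (by omega)]
      omega
    · have hmem : ∀ c, B.Present c (i - e - 1) → |c| ∈ B.toSweep.line (i - e - 1) := by
        intro c hc
        refine mem_filter.2 ⟨Sweep.abs_mem_arcs (S := B.toSweep) hc, ?_⟩
        rcases abs_choice c with h | h
        · rw [h]; exact Or.inl hc
        · rw [h, neg_neg]; exact Or.inr hc
      have hsub : B.toSweep.blk x z (i - e - 1) ⊆
          ((B.toSweep.line (i - e - 1)).erase |x|).erase |z| := by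
        intro c hc
        obtain ⟨f1, f2, b, f3, f4, rfl, f6⟩ := Sweep.mem_blk.1 hc
        exact mem_erase.2 ⟨f2, mem_erase.2 ⟨f1, hmem b f6⟩⟩
      have h1 := hmem x (hpast x hv.1)
      have h2 : |z| ∈ (B.toSweep.line (i - e - 1)).erase |x| :=
        mem_erase.2 ⟨hv.2.2.2.1.symm, hmem z (hpast z hv.2.1)⟩
      have h3 := card_le_card hsub
      rw [card_erase_of_mem h2, card_erase_of_mem h1] at h3
      have h4 := card_pos.2 ⟨_, h2⟩
      rw [card_erase_of_mem h1] at h4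
      omega
  -- `y` gains r, at most r - 1 other finishes lose one instant each, and the earlier start of `w₀`
  -- gains one.
  · have h1 : B'.len = ∑ w ∈ Icc 1 (n : ℤ), ((B.finish w - B.start w) + (if w = y then r else 0) -
        (if (B.finish w - t) % T ∈ Ioo 0 r then 1 else 0) +
        if (B.start w - t) % T = r then 1 else 0) := by
      refine sum_congr rfl fun w hw => ?_
      rw [mem_Icc] at hw
      change delay T t r (B.finish w) - delay T t r (B.start w) = _
      rw [hdstart w hw.1 hw.2, hdfinish w hw.1 hw.2]
      ring
    rw [h1, sum_add_distrib, sum_sub_distrib, sum_add_distrib, sum_ite_eq' (Icc 1 (n : ℤ)) y,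
      if_pos (mem_Icc.2 ⟨hy, hyn⟩), sum_boole, sum_boole]
    have h2 : ((Icc 1 (n : ℤ)).filter fun w => (B.finish w - t) % T ∈ Ioo 0 r).card ≤
        (Ioo 0 r).card := by
      refine card_le_card_of_injOn (fun w => (B.finish w - t) % T)
        (fun w hw => (mem_filter.1 hw).2) ?_
      intro w hw w' hw' h
      have e1 := mem_Icc.1 (mem_filter.1 hw).1
      have e2 := mem_Icc.1 (mem_filter.1 hw').1
      exact B.finish_inj e1.1 e1.2 e2.1 e2.2 (dvd_sub_iff.2 h)
    have h3 : 0 < ((Icc 1 (n : ℤ)).filter fun w => (B.start w - t) % T = r).card :=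
      card_pos.2 ⟨w₀, mem_filter.2 ⟨mem_Icc.2 ⟨hw1, hw2⟩, hw3⟩⟩
    rw [Int.card_Ioo] at h2
    unfold len
    omega

/-- If the line sometimes meets at most `m` arcs, then some arc can be prolonged. -/
lemma exists_longer_of_short (hmn : m < n) {j : ℤ} (hj : (B.toSweep.line j).card ≤ m) :
    ∃ B' : BarSystem n T, B.toSweep.edges m ⊆ B'.toSweep.edges m ∧ B.len < B'.len := by
  have hT := B.T_pos
  obtain ⟨v, hv, hvj⟩ : ∃ v ∈ Icc 1 (n : ℤ), v ∉ B.toSweep.line j := by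
    by_contra! h
    have := card_le_card h
    rw [Int.card_Icc] at this
    omega
  rw [mem_Icc] at hv
  obtain ⟨i, hi⟩ : ∃ i : ℤ, B.start v - T * i ≤ j := by
    refine ⟨|B.start v - j|, ?_⟩
    have := le_abs_self (B.start v - j)
    have := abs_nonneg (B.start v - j)
    nlinarith
  have h0 : ¬ B.toSweep.line (B.start v - T * i) ⊆ B.toSweep.line j := by
    intro h
    refine hvj (h ?_)
    rw [sub_eq_add_neg, ← mul_neg, line_add]
    refine mem_filter.2 ⟨Sweep.mem_arcs.2 hv, Or.inl ?_⟩
    exact (present_pos hv.1 hv.2).2 (met_start hv.1 hv.2)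
  -- From `s` to s + 1 the line loses its last arc not met at `j`; at most m arcs remain, so it
  -- meets at most m + 1 at `s`.
  obtain ⟨s, hs, -, h1, h2⟩ := Sweep.exists_step
    (P := fun i => ¬ B.toSweep.line i ⊆ B.toSweep.line j) hi h0 (not_not.2 subset_rfl)
  rw [not_not] at h2
  obtain ⟨y, hy, hyj⟩ := not_subset.1 (h1 s hs le_rfl)
  have hy' : y ∉ B.toSweep.line (s + 1) := fun h => hyj (h2 h)
  have hlost : ∀ c ∈ B.toSweep.line s, c ∉ B.toSweep.line (s + 1) →
      ∃ z, |z| = c ∧ B.Present z s ∧ ¬ B.Present z (s + 1) := by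
    intro c hc hc'
    obtain ⟨e1, e2⟩ := mem_filter.1 hc
    have e3 : ¬ (B.Present c (s + 1) ∨ B.Present (-c) (s + 1)) :=
      fun h => hc' (mem_filter.2 ⟨e1, h⟩)
    rw [not_or] at e3
    rcases e2 with e2 | e2
    · exact ⟨c, Sweep.abs_of_mem e1, e2, e3.1⟩
    · exact ⟨-c, by rw [abs_neg, Sweep.abs_of_mem e1], e2, e3.2⟩
  obtain ⟨z, hz, hz1, hz2⟩ := hlost y hy hy'
  have hcard : (B.toSweep.line s).card ≤ m + 1 := by
    have hsub : B.toSweep.line s ⊆ insert y (B.toSweep.line (s + 1)) := by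
      intro c hc
      by_cases hc' : c ∈ B.toSweep.line (s + 1)
      · exact mem_insert_of_mem hc'
      · obtain ⟨x, hx, hx1, hx2⟩ := hlost c hc hc'
        have : x = z := B.toSweep.single (t := s) (iff_of_true hx1 hx2) (iff_of_true hz1 hz2)
        rw [← hx, this, hz]; exact mem_insert_self _ _
    have h3 := (card_le_card hsub).trans (card_insert_le _ _)
    have h4 := card_le_card h2
    omega
  obtain ⟨⟨g1, g2⟩, l, hl⟩ := present_finish_unique hz1 hz2
  rw [hz] at g1 g2 hl
  obtain ⟨c', hc'⟩ : ∃ k : ℤ, (if 0 < z then 0 else T) = T * k := by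
    split_ifs; exacts [⟨0, by simp⟩, ⟨1, by simp⟩]
  rw [hc'] at hl
  have hs : B.finish y = s + 1 + T * (c' - 2 * l) := by linear_combination -hl
  refine exists_longer g1 g2 ?_ ?_
  · rw [hs, line_add]; exact hy'
  · rw [hs, show s + 1 + T * (c' - 2 * l) - 1 = s + T * (c' - 2 * l) by ring, line_add]
    exact hcard

/-- The bound for all bar systems. -/
theorem card_edges_le (hmn : m < n) (B : BarSystem n T) :
    2 * (B.toSweep.edges m).card + 3 * m * (m + 1) ≤ 6 * m * n := by
  obtain ⟨N, hN⟩ : ∃ N : ℕ, (n * (2 * T) - B.len).toNat = N := ⟨_, rfl⟩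
  induction N using Nat.strong_induction_on generalizing B with
  | _ N ih =>
    by_cases hlong : ∀ t, m + 1 ≤ (B.toSweep.line t).card
    · exact Sweep.card_edges_le hmn.le hlong
    push Not at hlong
    obtain ⟨j, hj⟩ := hlong
    obtain ⟨B', h1, h2⟩ := exists_longer_of_short hmn (B := B) (j := j) (by omega)
    have h3 := card_le_card h1
    have h4 := B'.len_le
    have h5 := ih _ (by omega) B' rfl
    omega

end BarSystem

/-! ### Discretizing angles -/

/-- The index of an angle in a subdivision of the half turn into `Q` parts. -/
def angleIndex (Q : ℤ) (x : ℝ) : ℤ := ⌊(Q : ℝ) * (x / Real.pi)⌋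

lemma angleIndex_add (Q : ℤ) (x : ℝ) (l : ℤ) :
    angleIndex Q (x + Real.pi * l) = angleIndex Q x + Q * l := by
  unfold angleIndex
  rw [← Int.floor_add_intCast]
  congr 1
  push_cast
  field_simp

lemma angleIndex_mono {Q : ℤ} (hQ : 0 < Q) {x y : ℝ} (h : x ≤ y) :
    angleIndex Q x ≤ angleIndex Q y := by
  have : (0 : ℝ) < Q := by exact_mod_cast hQ
  have := Real.pi_pos
  unfold angleIndex
  gcongr

/-- Finitely many angles are separated modulo the half turn by a fine subdivision. -/
lemma exists_angleIndex_lt (Θ : Finset ℝ) : ∃ Q : ℤ, 0 < Q ∧ ∀ x ∈ Θ, ∀ y ∈ Θ, ∀ i : ℤ,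
    x + Real.pi * i < y → angleIndex Q x + Q * i < angleIndex Q y := by
  have hpi := Real.pi_pos
  -- The least positive value of (y - x)/π - i over integers i. Once Q ≥ 1/δ, the scaled angles
  -- differ by at least 1, and so do their floors.
  let δ : ℝ × ℝ → ℝ := fun p => (p.2 - p.1) / Real.pi - (⌈(p.2 - p.1) / Real.pi⌉ - 1)
  have hδ : ∀ p, 0 < δ p := fun p => by
    have := Int.ceil_lt_add_one ((p.2 - p.1) / Real.pi)
    simp only [δ]; linarith
  obtain ⟨M, hM⟩ := ((Θ ×ˢ Θ).image fun p => 1 / δ p).exists_le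
  refine ⟨⌈max M 1⌉, Int.ceil_pos.2 (by positivity), fun x hx y hy i h => ?_⟩
  have hQ : 1 / δ (x, y) ≤ (⌈max M 1⌉ : ℤ) :=
    (hM _ (mem_image_of_mem _ (mem_product.2 ⟨hx, hy⟩))).trans
      ((le_max_left _ _).trans (Int.le_ceil _))
  have hQ0 : (0 : ℝ) < (⌈max M 1⌉ : ℤ) := lt_of_lt_of_le (one_div_pos.2 (hδ _)) hQ
  rw [div_le_iff₀ (hδ _)] at hQ
  have hi : (i : ℝ) < (y - x) / Real.pi := by rw [lt_div_iff₀ hpi]; linarith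
  have hi' : i ≤ ⌈(y - x) / Real.pi⌉ - 1 := by
    have := Int.lt_ceil.2 hi
    omega
  have hi'' : (i : ℝ) ≤ (⌈(y - x) / Real.pi⌉ : ℤ) - 1 := by exact_mod_cast hi'
  have h1 : δ (x, y) ≤ y / Real.pi - x / Real.pi - i := by
    simp only [δ]; rw [sub_div] at *; linarith
  have h2 := mul_le_mul_of_nonneg_left h1 hQ0.le
  rw [← Int.add_one_le_iff, angleIndex, angleIndex, Int.le_floor]
  push_cast
  have := Int.floor_le ((⌈max M 1⌉ : ℤ) * (x / Real.pi))
  linarith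

/-- The vertices can be numbered by increasing radius. -/
lemma exists_index {V : Type*} [Fintype V] (f : V → ℝ) : ∃ idx : V → ℤ, Function.Injective idx ∧
    (∀ v, 1 ≤ idx v ∧ idx v ≤ Fintype.card V) ∧
    (∀ w : ℤ, 1 ≤ w → w ≤ Fintype.card V → ∃ v, idx v = w) ∧
    ∀ u v, idx u ≤ idx v → f u ≤ f v := by
  let e := Fintype.equivFin V
  let σ := Tuple.sort (f ∘ e.symm)
  have hσ : Monotone ((f ∘ e.symm) ∘ σ) := Tuple.monotone_sort _
  refine ⟨fun v => ((σ.symm (e v) : ℕ) : ℤ) + 1, ?_, fun v => ?_,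
    fun w h1 h2 => ?_, fun u v h => ?_⟩
  · intro u v h
    simp only [add_left_inj, Nat.cast_inj] at h
    exact e.injective (σ.symm.injective (Fin.ext h))
  · have := (σ.symm (e v)).2
    dsimp only
    omega
  · refine ⟨e.symm (σ ⟨(w - 1).toNat, by omega⟩), ?_⟩
    simp
    omega
  · have h' : σ.symm (e u) ≤ σ.symm (e v) := by
      rw [Fin.le_def]; simp only at h; omega
    simpa using hσ h'

/-! ### Radial segments and the bar system of a family of arcs -/

namespace CircularArc

/-- Visibility of two arcs along the line with the angle `α`. -/
lemma exists_angle {V : Type*} {a : V → CircularArc} {k : ℕ} {u v : V} (h : KVisible a k u v) :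
    ∃ α : ℝ, ∃ j : ℤ, (a u).neg ≤ α ∧ α ≤ (a u).pos ∧ (a v).neg ≤ α + Real.pi * j ∧
      α + Real.pi * j ≤ (a v).pos ∧
      {w : V | w ≠ u ∧ w ≠ v ∧ ((a w).points ∩ segment ℝ
        (((a u).radius : ℂ) * Complex.exp (α * Complex.I))
        (((-1) ^ j * (a v).radius : ℂ) * Complex.exp (α * Complex.I))).Nonempty}.encard ≤ k := by
  obtain ⟨-, p, ⟨α, hα, rfl⟩, q, ⟨β, hβ, rfl⟩, hcol, hk⟩ := h
  have hu := (a u).radius_pos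
  have hv := (a v).radius_pos
  obtain ⟨w, hw⟩ := (collinear_iff_of_mem (k := ℝ) (p₀ := (0 : ℂ)) (by simp)).1 hcol
  obtain ⟨c, hc⟩ := hw _ (Set.mem_insert_of_mem _ (Set.mem_insert _ _))
  obtain ⟨d, hd⟩ := hw _ (Set.mem_insert_of_mem _ (Set.mem_insert_of_mem _ (Set.mem_singleton _)))
  simp only [vadd_eq_add, add_zero, Complex.real_smul] at hc hd
  have hsin : Real.sin (β - α) = 0 := by
    have h1 : (c : ℂ) * (((a v).radius : ℂ) * Complex.exp (β * Complex.I)) =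
        d * (((a u).radius : ℂ) * Complex.exp (α * Complex.I)) := by
      rw [hc, hd]; ring
    have hc0 : c ≠ 0 := by
      rintro rfl
      have : ((a u).radius : ℂ) ≠ 0 := by exact_mod_cast hu.ne'
      simp [this] at hc
    have h2 : (c : ℂ) * (((a v).radius : ℂ) * Complex.exp ((β - α : ℝ) * Complex.I)) =
        d * ((a u).radius : ℂ) := by
      have : ((β - α : ℝ) : ℂ) * Complex.I = β * Complex.I + -(α * Complex.I) := by push_cast; ring
      rw [this, Complex.exp_add]
      calc (c : ℂ) * ((a v).radius * (Complex.exp (β * Complex.I) * Complex.exp (-(α * Complex.I))))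
          = (c * ((a v).radius * Complex.exp (β * Complex.I))) *
            Complex.exp (-(α * Complex.I)) := by
            ring
        _ = d * (a u).radius * (Complex.exp (α * Complex.I) * Complex.exp (-(α * Complex.I))) := by
            rw [h1]; ring
        _ = _ := by rw [← Complex.exp_add, add_neg_cancel, Complex.exp_zero, mul_one]
    have h3 := congrArg Complex.im h2
    rw [← mul_assoc, ← Complex.ofReal_mul, ← Complex.ofReal_mul, Complex.im_ofReal_mul,
      Complex.exp_ofReal_mul_I_im, Complex.ofReal_im] at h3
    rcases mul_eq_zero.1 h3 with h | h
    · exact absurd h (mul_ne_zero hc0 hv.ne')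
    · exact h
  obtain ⟨j, hj⟩ := Real.sin_eq_zero_iff.1 hsin
  have hβα : β = α + Real.pi * j := by linarith
  have hq : ((a v).radius : ℂ) * Complex.exp (β * Complex.I) =
      ((-1) ^ j * (a v).radius : ℂ) * Complex.exp (α * Complex.I) := by
    rw [hβα]
    have : ((α + Real.pi * j : ℝ) : ℂ) * Complex.I = α * Complex.I + j * (Real.pi * Complex.I) := by
      push_cast; ring
    rw [this, Complex.exp_add, Complex.exp_int_mul, Complex.exp_pi_mul_I]
    ring
  refine ⟨α, j, hα.1, hα.2, hβα ▸ hβ.1, hβα ▸ hβ.2, ?_⟩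
  rw [← hq]
  exact hk

lemma mem_points {A : CircularArc} {α : ℝ} {j : ℤ} (h1 : A.neg ≤ α + Real.pi * j)
    (h2 : α + Real.pi * j ≤ A.pos) :
    ((-1) ^ j * A.radius : ℂ) * Complex.exp (α * Complex.I) ∈ A.points := by
  refine ⟨α + Real.pi * j, ⟨h1, h2⟩, ?_⟩
  have : ((α + Real.pi * j : ℝ) : ℂ) * Complex.I = α * Complex.I + j * (Real.pi * Complex.I) := by
    push_cast; ring
  simp only
  rw [this, Complex.exp_add, Complex.exp_int_mul, Complex.exp_pi_mul_I]
  ring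

end CircularArc

lemma mul_mem_segment {x y z : ℝ} (e : ℂ) (h : z ∈ Set.uIcc x y) :
    (z : ℂ) * e ∈ segment ℝ ((x : ℂ) * e) ((y : ℂ) * e) := by
  rw [← segment_eq_uIcc] at h
  have := Set.mem_image_of_mem (LinearMap.toSpanSingleton ℝ ℂ e).toAffineMap h
  rw [image_segment] at this
  simpa [LinearMap.toSpanSingleton_apply, Complex.real_smul] using this

namespace BarSystem

variable {n : ℕ} {Q : ℤ} {A : ℤ → CircularArc}

/-- The bar system of a family of arcs, for a subdivision of the half turn into `Q` parts. -/
def ofArcs (n : ℕ) (Q : ℤ) (A : ℤ → CircularArc) (hQ : 0 < Q)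
    (h : ∀ w, 1 ≤ w → w ≤ (n : ℤ) → angleIndex Q (A w).pos < angleIndex Q (A w).neg + 2 * Q) :
    BarSystem n ((2 * n + 1) * Q) where
  -- Each angle index owns 2n + 1 instants: starts at offsets 1, …, n, finishes at n + 1, …, 2n. At
  -- offset n every arc that starts or finishes at this index is met, as is right for closed arcs.
  -- Starts and finishes have distinct offsets modulo 2n + 1, which divides the half turn.
  start w := (2 * n + 1) * angleIndex Q (A w).neg + w
  finish w := (2 * n + 1) * angleIndex Q (A w).pos + n + w
  T_pos := by positivity
  start_lt {w} h1 h2 := by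
    have := mul_le_mul_of_nonneg_left (angleIndex_mono hQ (A w).neg_lt_pos.le)
      (by positivity : (0 : ℤ) ≤ 2 * n + 1)
    omega
  finish_lt {w} h1 h2 := by
    have := mul_le_mul_of_nonneg_left (Int.add_one_le_iff.2 (h w h1 h2))
      (by positivity : (0 : ℤ) ≤ 2 * n + 1)
    nlinarith
  start_inj {w w'} h1 h2 h3 h4 h := by
    obtain ⟨c, hc⟩ := h
    have hd : (2 * n + 1 : ℤ) ∣ w - w' :=
      ⟨Q * c - angleIndex Q (A w).neg + angleIndex Q (A w').neg, by linear_combination hc⟩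
    have := Int.eq_zero_of_abs_lt_dvd hd (by rw [abs_lt]; omega)
    omega
  finish_inj {w w'} h1 h2 h3 h4 h := by
    obtain ⟨c, hc⟩ := h
    have hd : (2 * n + 1 : ℤ) ∣ w - w' :=
      ⟨Q * c - angleIndex Q (A w).pos + angleIndex Q (A w').pos, by linear_combination hc⟩
    have := Int.eq_zero_of_abs_lt_dvd hd (by rw [abs_lt]; omega)
    omega
  start_ne_finish {w w'} h1 h2 h3 h4 h := by
    obtain ⟨c, hc⟩ := h
    have hd : (2 * n + 1 : ℤ) ∣ w - (n + w') :=
      ⟨Q * c - angleIndex Q (A w).neg + angleIndex Q (A w').pos, by linear_combination hc⟩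
    have := Int.eq_zero_of_abs_lt_dvd hd (by rw [abs_lt]; omega)
    omega

lemma met_ofArcs {hQ : 0 < Q} {h} {Θ : Finset ℝ} {α : ℝ} {w l : ℤ}
    (hΘ : ∀ x ∈ Θ, ∀ y ∈ Θ, ∀ i : ℤ,
      x + Real.pi * i < y → angleIndex Q x + Q * i < angleIndex Q y)
    (hα : α ∈ Θ) (hneg : (A w).neg ∈ Θ) (hpos : (A w).pos ∈ Θ) (h1 : 1 ≤ w) (h2 : w ≤ n) :
    (ofArcs n Q A hQ h).Met w ((2 * n + 1) * (angleIndex Q α + Q * l) + n) ↔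
      ∃ i : ℤ, (A w).neg ≤ α + Real.pi * (l - 2 * i : ℤ) ∧
        α + Real.pi * (l - 2 * i : ℤ) ≤ (A w).pos := by
  refine exists_congr fun i => ?_
  change (2 * n + 1) * angleIndex Q (A w).neg + w + 2 * ((2 * n + 1) * Q) * i ≤ _ ∧
    _ < (2 * n + 1) * angleIndex Q (A w).pos + n + w + 2 * ((2 * n + 1) * Q) * i ↔ _
  have hadd := angleIndex_add Q α (l - 2 * i)
  set X := angleIndex Q (α + Real.pi * (l - 2 * i : ℤ)) with hX
  have e1 : (2 * n + 1) * (angleIndex Q α + Q * l) =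
      (2 * n + 1) * X + 2 * ((2 * n + 1) * Q) * i := by rw [hadd]; ring
  rw [e1]
  have hn : (0 : ℤ) ≤ 2 * n + 1 := by positivity
  constructor
  · rintro ⟨f1, f2⟩
    constructor
    · by_contra! hlt
      have := hΘ _ hα _ hneg _ hlt
      rw [← hadd] at this
      have := mul_le_mul_of_nonneg_left (Int.add_one_le_iff.2 this) hn
      rw [mul_add] at this
      omega
    · by_contra! hlt
      have := hΘ _ hpos _ hα (-(l - 2 * i)) (by push_cast at hlt ⊢; linarith)
      have : angleIndex Q (A w).pos < X := by rw [hadd]; linarith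
      have := mul_le_mul_of_nonneg_left (Int.add_one_le_iff.2 this) hn
      rw [mul_add] at this
      omega
  · rintro ⟨f1, f2⟩
    have g1 := mul_le_mul_of_nonneg_left (angleIndex_mono hQ f1) hn
    have g2 := mul_le_mul_of_nonneg_left (angleIndex_mono hQ f2) hn
    rw [← hX] at g1 g2
    constructor <;> omega

/-- A bar is present if and only if the line meets the arc on the corresponding ray. -/
lemma present_ofArcs {hQ : 0 < Q} {h} {Θ : Finset ℝ} {α : ℝ} {z : ℤ}
    (hΘ : ∀ x ∈ Θ, ∀ y ∈ Θ, ∀ i : ℤ,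
      x + Real.pi * i < y → angleIndex Q x + Q * i < angleIndex Q y)
    (hα : α ∈ Θ) (hneg : (A |z|).neg ∈ Θ) (hpos : (A |z|).pos ∈ Θ) (h1 : 1 ≤ |z|) (h2 : |z| ≤ n) :
    (ofArcs n Q A hQ h).Present z ((2 * n + 1) * angleIndex Q α + n) ↔
      ∃ j : ℤ, (Even j ↔ 0 < z) ∧ (A |z|).neg ≤ α + Real.pi * j ∧
        α + Real.pi * j ≤ (A |z|).pos := by
  rcases lt_or_gt_of_ne (abs_pos.1 (by omega : 0 < |z|)) with hz | hz
  · rw [abs_of_neg hz] at *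
    rw [present_neg h1 h2]
    have := met_ofArcs (hQ := hQ) (h := h) (l := 1) hΘ hα hneg hpos h1 h2
    rw [mul_one, mul_add, add_right_comm] at this
    rw [this]
    constructor
    · rintro ⟨i, hi⟩
      exact ⟨1 - 2 * i, by simp [hz.not_gt, parity_simps], hi⟩
    · rintro ⟨j, hj, hi⟩
      have : Odd j := by rw [← Int.not_even_iff_odd, hj]; omega
      obtain ⟨i, rfl⟩ := this
      exact ⟨-i, by convert hi using 4 <;> ring_nf⟩
  · rw [abs_of_pos hz] at *
    rw [present_pos h1 h2]
    have := met_ofArcs (hQ := hQ) (h := h) (l := 0) hΘ hα hneg hpos h1 h2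
    rw [mul_zero, add_zero] at this
    rw [this]
    constructor
    · rintro ⟨i, hi⟩
      exact ⟨0 - 2 * i, by simp [hz], hi⟩
    · rintro ⟨j, hj, hi⟩
      obtain ⟨i, rfl⟩ := hj.2 hz
      exact ⟨-i, by convert hi using 4 <;> ring_nf⟩

end BarSystem

/-! ### Embedding arc visibility graphs -/

/-- The signed radius of a bar. -/
def barRadius (A : ℤ → CircularArc) (z : ℤ) : ℝ :=
  if 0 < z then (A z).radius else -(A (-z)).radius

lemma barRadius_mono {n : ℕ} {A : ℤ → CircularArc}
    (hA : ∀ w w', 1 ≤ w → w ≤ w' → w' ≤ (n : ℤ) → (A w).radius ≤ (A w').radius) {x y : ℤ}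
    (hxn : |x| ≤ n) (hy : y ≠ 0) (hyn : |y| ≤ n) (hxy : x ≤ y) :
    barRadius A x ≤ barRadius A y := by
  rw [abs_le] at hxn hyn
  unfold barRadius
  split_ifs with h1 h2
  · exact hA _ _ (by omega) hxy hyn.2
  · omega
  · have := (A y).radius_pos
    have := (A (-x)).radius_pos
    linarith
  · exact neg_le_neg (hA _ _ (by omega) (by omega) (by omega))

lemma barRadius_eq {A : ℤ → CircularArc} {z j : ℤ} (hz : z ≠ 0) (hj : Even j ↔ 0 < z) :
    ((-1) ^ j * (A |z|).radius : ℂ) = barRadius A z := by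
  unfold barRadius
  rcases lt_or_gt_of_ne hz with h | h
  · have : Odd j := by rw [← Int.not_even_iff_odd, hj]; omega
    rw [if_neg (by omega), this.neg_one_zpow, abs_of_neg h]; simp
  · rw [if_pos h, (hj.2 h).neg_one_zpow, abs_of_pos h]; simp

/-- Arc visibility graphs embed into the visibility graphs of bar systems. -/
lemma exists_barSystem {V : Type*} [Fintype V] [Nonempty V] {k : ℕ} {G : SimpleGraph V}
    (hG : IsArcVisibilityGraph k G) : ∃ T : ℤ, ∃ B : BarSystem (Fintype.card V) T,
      G.edgeSet.ncard ≤ (B.toSweep.edges (k + 1)).card := by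
  obtain ⟨a, -, hadj⟩ := hG
  set n := Fintype.card V with hn
  obtain ⟨idx, hinj, hrange, hsurj, hmono⟩ := exists_index fun v => (a v).radius
  have hvtx : ∀ w : ℤ, ∃ v, 1 ≤ w → w ≤ n → idx v = w := by
    intro w
    by_cases h : 1 ≤ w ∧ w ≤ n
    · obtain ⟨v, hv⟩ := hsurj w h.1 h.2; exact ⟨v, fun _ _ => hv⟩
    · exact ⟨Classical.arbitrary V, fun h1 h2 => absurd ⟨h1, h2⟩ h⟩
  choose vtx hvtx using hvtx
  have hvi : ∀ v, vtx (idx v) = v := fun v =>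
    hinj (hvtx _ (hrange v).1 (hrange v).2)
  let A : ℤ → CircularArc := fun w => a (vtx w)
  have hA : ∀ w w', 1 ≤ w → w ≤ w' → w' ≤ (n : ℤ) → (A w).radius ≤ (A w').radius := by
    intro w w' h1 h2 h3
    refine hmono _ _ ?_
    rw [hvtx w h1 (h2.trans h3), hvtx w' (h1.trans h2) h3]
    exact h2
  -- One witnessing angle per pair is enough, so `Θ` stays finite and a single `Q` separates all
  -- relevant angles.
  have hang : ∀ p : V × V, ∃ α : ℝ, KVisible a k p.1 p.2 → ∃ j : ℤ, (a p.1).neg ≤ α ∧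
      α ≤ (a p.1).pos ∧ (a p.2).neg ≤ α + Real.pi * j ∧ α + Real.pi * j ≤ (a p.2).pos ∧
      {w : V | w ≠ p.1 ∧ w ≠ p.2 ∧ ((a w).points ∩ segment ℝ
        (((a p.1).radius : ℂ) * Complex.exp (α * Complex.I))
        (((-1) ^ j * (a p.2).radius : ℂ) * Complex.exp (α * Complex.I))).Nonempty}.encard ≤ k := by
    intro p
    by_cases h : KVisible a k p.1 p.2
    · obtain ⟨α, hα⟩ := CircularArc.exists_angle h; exact ⟨α, fun _ => hα⟩
    · exact ⟨0, fun h' => absurd h' h⟩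
  choose ang hang using hang
  set Θ : Finset ℝ := univ.image (fun v => (a v).neg) ∪ univ.image (fun v => (a v).pos) ∪
    univ.image ang with hΘdef
  have hneg : ∀ v, (a v).neg ∈ Θ := fun v =>
    mem_union_left _ (mem_union_left _ (mem_image_of_mem _ (mem_univ v)))
  have hpos : ∀ v, (a v).pos ∈ Θ := fun v =>
    mem_union_left _ (mem_union_right _ (mem_image_of_mem _ (mem_univ v)))
  have hangm : ∀ p, ang p ∈ Θ := fun p => mem_union_right _ (mem_image_of_mem _ (mem_univ p))
  obtain ⟨Q, hQ, hΘ⟩ := exists_angleIndex_lt Θ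
  have hlen : ∀ w, 1 ≤ w → w ≤ (n : ℤ) →
      angleIndex Q (A w).pos < angleIndex Q (A w).neg + 2 * Q := by
    intro w _ _
    have := hΘ _ (hpos (vtx w)) _ (hneg (vtx w)) (-2)
      (by have := (a (vtx w)).pos_lt; push_cast; linarith)
    linarith
  let B := BarSystem.ofArcs n Q A hQ hlen
  refine ⟨_, B, ?_⟩
  have hmain : ∀ u v, G.Adj u v → s(idx u, idx v) ∈ B.toSweep.edges (k + 1) := by
    intro u v huv
    have hvis := (hadj u v).1 huv
    obtain ⟨j, h1, h2, h3, h4, hk⟩ := hang (u, v) hvis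
    set α := ang (u, v) with hα
    simp only at h1 h2 h3 h4 hk
    set t := (2 * n + 1) * angleIndex Q α + n with ht
    have hpres : ∀ z : ℤ, 1 ≤ |z| → |z| ≤ n → (B.Present z t ↔ ∃ j : ℤ, (Even j ↔ 0 < z) ∧
        (A |z|).neg ≤ α + Real.pi * j ∧ α + Real.pi * j ≤ (A |z|).pos) := fun z g1 g2 =>
      BarSystem.present_ofArcs hΘ (hangm _) (hneg _) (hpos _) g1 g2
    -- The positive ray is the one through the point on the arc of `u`; the point on the arc of `v`
    -- is on the same ray exactly when `j` is even.
    obtain ⟨x, hx0, hxabs⟩ : ∃ x : ℤ, (Even (0 : ℤ) ↔ 0 < x) ∧ |x| = idx u :=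
      ⟨idx u, by have := hrange u; simp; omega, abs_of_pos (by have := hrange u; omega)⟩
    obtain ⟨y, hy0, hyabs⟩ : ∃ y : ℤ, (Even j ↔ 0 < y) ∧ |y| = idx v := by
      have := hrange v
      by_cases hj : Even j
      · exact ⟨idx v, by simp [hj]; omega, abs_of_pos (by omega)⟩
      · exact ⟨-idx v, by simp [hj]; omega, by rw [abs_neg]; exact abs_of_pos (by omega)⟩
    have hxr : 1 ≤ |x| ∧ |x| ≤ n := by rw [hxabs]; exact hrange u
    have hyr : 1 ≤ |y| ∧ |y| ≤ n := by rw [hyabs]; exact hrange v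
    have hxz : x ≠ 0 := by rintro rfl; simp at hxr
    have hyz : y ≠ 0 := by rintro rfl; simp at hyr
    have hAx : A |x| = a u := by simp only [A]; rw [hxabs, hvi]
    have hAy : A |y| = a v := by simp only [A]; rw [hyabs, hvi]
    have hpx : B.Present x t := (hpres x hxr.1 hxr.2).2 ⟨0, hx0, by simpa [hAx], by simpa [hAx]⟩
    have hpy : B.Present y t := (hpres y hyr.1 hyr.2).2 ⟨j, hy0, by rwa [hAy], by rwa [hAy]⟩
    have hne : |x| ≠ |y| := by rw [hxabs, hyabs]; exact fun h => hvis.1 (hinj h)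
    have ex := barRadius_eq (A := A) hxz hx0
    have ey := barRadius_eq (A := A) hyz hy0
    rw [hAx, zpow_zero, one_mul] at ex
    rw [hAy] at ey
    rw [ex, ey] at hk
    have hblk : ∀ x' y' : ℤ, (x' = x ∧ y' = y ∨ x' = y ∧ y' = x) →
        (B.toSweep.blk x' y' t).card < k + 1 := by
      intro x' y' hxy
      have : ((B.toSweep.blk x' y' t).card : ℕ∞) ≤ k := by
        refine le_trans ?_ hk
        rw [← Set.encard_coe_eq_coe_finsetCard]
        refine Set.encard_le_encard_of_injOn (f := vtx) ?_ ?_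
        · intro c hc
          obtain ⟨f1, f2, z, f3, f4, rfl, f6⟩ := Sweep.mem_blk.1 hc
          have hz0 : z ≠ 0 := B.toSweep.ne_zero f6
          have hzn : |z| ≤ n := B.toSweep.abs_le f6
          have hz1 : 1 ≤ |z| := Int.one_le_abs hz0
          have hi := hvtx |z| hz1 hzn
          have hzx : |z| ≠ |x| ∧ |z| ≠ |y| := by
            rcases hxy with ⟨rfl, rfl⟩ | ⟨rfl, rfl⟩
            exacts [⟨f1, f2⟩, ⟨f2, f1⟩]
          refine ⟨?_, ?_, ?_⟩
          · intro h; rw [h] at hi; exact hzx.1 (by rw [hxabs, hi])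
          · intro h; rw [h] at hi; exact hzx.2 (by rw [hyabs, hi])
          obtain ⟨i, g1, g2, g3⟩ := (hpres z hz1 hzn).1 f6
          refine ⟨(barRadius A z : ℂ) * Complex.exp (α * Complex.I), ?_, ?_⟩
          · rw [← barRadius_eq hz0 g1]
            exact CircularArc.mem_points g2 g3
          -- Equal radii make signed radii only weakly monotone in the bars; weak betweenness
          -- already puts the point on the closed segment.
          · refine mul_mem_segment _ ?_
            have m1 : y' ≤ z := f3.le
            have m2 : z ≤ x' := f4.le
            rw [Set.mem_uIcc]
            rcases hxy with ⟨rfl, rfl⟩ | ⟨rfl, rfl⟩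
            · exact Or.inr ⟨barRadius_mono hA hyr.2 hz0 hzn m1,
                barRadius_mono hA hzn hxz hxr.2 m2⟩
            · exact Or.inl ⟨barRadius_mono hA hxr.2 hz0 hzn m1,
                barRadius_mono hA hzn hyz hyr.2 m2⟩
        · intro c hc c' hc' h
          have r1 := Sweep.mem_arcs.1 (mem_filter.1 hc).1
          have r2 := Sweep.mem_arcs.1 (mem_filter.1 hc').1
          rw [← hvtx c r1.1 r1.2, ← hvtx c' r2.1 r2.2, h]
      have : (B.toSweep.blk x' y' t).card ≤ k := by exact_mod_cast this
      omega
    refine Sweep.mem_edges.2 ?_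
    rcases lt_or_gt_of_ne (fun h => hne (by rw [h]) : x ≠ y) with h | h
    · exact ⟨y, x, t, ⟨hpy, hpx, h, hne.symm, hblk y x (Or.inr ⟨rfl, rfl⟩)⟩, by
        rw [hxabs, hyabs, Sym2.eq_swap]⟩
    · exact ⟨x, y, t, ⟨hpx, hpy, h, hne, hblk x y (Or.inl ⟨rfl, rfl⟩)⟩, by rw [hxabs, hyabs]⟩
  rw [← Set.ncard_coe_finset]
  refine Set.ncard_le_ncard_of_injOn (Sym2.map idx) ?_ (Sym2.map.injective hinj).injOn
    (Finset.finite_toSet _)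
  intro s
  induction s using Sym2.ind with
  | _ u v => exact fun h => hmain u v h

end

theorem mainTheorem1 {V : Type*} [Fintype V] (k : ℕ) (G : SimpleGraph V)
    (hG : IsArcVisibilityGraph k G) :
    (Fintype.card V ≤ 4 * k + 4 → G.edgeSet.ncard ≤ (Fintype.card V).choose 2) ∧
    (4 * k + 4 < Fintype.card V →
      (G.edgeSet.ncard : ℝ) ≤
        ((k : ℝ) + 1) * (3 * (Fintype.card V : ℝ) - (3 * (k : ℝ) + 6) / 2)) := by
  classical
  refine ⟨fun _ => ?_, fun hn => ?_⟩
  · rw [← SimpleGraph.coe_edgeFinset, Set.ncard_coe_finset]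
    exact G.card_edgeFinset_le_card_choose_two
  · have : Nonempty V := Fintype.card_pos_iff.1 (by omega)
    obtain ⟨T, B, hB⟩ := exists_barSystem hG
    have h := BarSystem.card_edges_le (m := k + 1) (by omega) B
    have h' : 2 * G.edgeSet.ncard + 3 * (k + 1) * (k + 1 + 1) ≤ 6 * (k + 1) * Fintype.card V := by
      omega
    have h'' : (2 * G.edgeSet.ncard + 3 * (k + 1) * (k + 1 + 1) : ℝ) ≤
        6 * (k + 1) * Fintype.card V := by exact_mod_cast h'
    linarith
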